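/- Let $c\in[0,1)$ be fixed and let $X$ be a tempered stable subordinator with shape $a>0$, rate $b>0$ and family parameter $c$: a Lévy subordinator with $\mathsf{E}e^{-uX_t}=\phi_{X_1}(u)^t$ for $u>-b$, where $\phi_{X_1}(u)=\exp\big(a\Gamma(-c)((u+b)^c-b^c)\big)$ if $c\in(0,1)$ and $\phi_{X_1}(u)=(1+u/b)^{-a}$ if $c=0$. Let $n\ge 0$ and let $T$ be a regulated $X$-clock of degree $n$ and of type I, II or III. For $n=0$, $T=X$. For an integer $n\ge1$, $T$ is a Lévy subordinator such that, for every $t>0$, $T_t$ is equal in law to the $n$-fold running average of $X$ at time $t$ (type I; one running average maps a process $(Y_t)$ to $\frac1t\int_0^tY_s\,ds$), to the running average at time $t$ of a type-II clock of degree $n-1$ (type II), or to $t^{-n}$ times the $n$-fold iterated integral of $X$ over $[0,t]$ (type III). For any real $n>0$, $T$ is alternatively allowed to be the Lévy subordinator with $\log\mathsf{E}e^{-uT_t}$ equal, for $u\geq 0$ and for $u$ near $0$, to $$t\int_0^1\log\phi_{X_1}\big(k_n(s)u\big)ds,\qquad \frac{t}{\Gamma(n)}\int_0^1(-\log v)^{n-1}\log\phi_{X_1}(uv)\,dv,\qquad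 t\int_0^1\log\phi_{X_1}\Big(\frac{s^nu}{\Gamma(n+1)}\Big)ds$$ for types I, II, III respectively, where $k_n(s)=1-\Gamma(n,-\log s)/\Gamma(n)$ and $\Gamma(\cdot,\cdot)$ is the upper incomplete gamma function. Put $$\rho(m,n)=\int_0^1k_n(s)^m\,ds\ \ (\text{type I},\ n>0;\ \ \rho(m,0)=1),\qquad \rho(m,n)=\frac1{(m+1)^n}\ \ (\text{type II}),\qquad \rho(m,n)=\frac1{(mn+1)\Gamma(n+1)^m}\ \ (\text{type III}).$$ Let $W$ be a standard Brownian motion independent of $T$, let $\mu,\theta\in\mathbb{R}$, and let $\Xi_t=\mu t+\theta T_t+W_{T_t}$. For $\Delta>0$ let $K_\Delta(m)$ be the $m$-th cumulant of $\Xi_\Delta$, i.e. the $m$-th derivative at $0$ of $z\mapsto\log\mathsf{E}e^{z\Xi_\Delta}$. Let $[M]$, $[V]>0$, $[SK]\neq0$ and $[EK]$ be real numbers (the mean, variance, skewness and excess kurtosis of a sample observed at time step $\Delta$). The parameters $(a,b,\mu,\theta)$ are called moment-based estimates if $$K_\Delta(1)=[M],\quad K_\Delta(2)=[V],\quad K_\Delta(3)=[SK][V]^{3/2},\quad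 \frac{K_\Delta(3)}{K_\Delta(4)}=\frac{[SK]}{[EK][V]^{1/2}}.$$ Then $\mathsf{E}e^{z\Xi_\Delta}<\infty$ for all real $z$ in a neighbourhood of $0$, so that the cumulants exist, and $(a,b,\mu,\theta)$ (with $a,b>0$) are moment-based estimates if and only if $$b=\frac{2(2-c)\rho(3,n)\theta^2}{\rho(2,n)P(|\theta|)},\qquad a=\frac{[V]b^{1-c}}{\Delta\,\Gamma(1-c)\big(\rho(1,n)+(1-c)\rho(2,n)\theta^2/b\big)},$$ $$\mu=\frac{[M]}{\Delta}-\frac{\rho(1,n)\theta[V]}{\Delta\big(\rho(1,n)+(1-c)\rho(2,n)\theta^2/b\big)},$$ $\theta=\mathrm{sgn}([SK])\,|\theta|$, and $|\theta|$ solves $$\frac{(3-c)\rho(2,n)\rho(4,n)}{4(2-c)\rho(3,n)^2}P^2(|\theta|)+\Big(3-\frac{[EK][V]^{1/2}|\theta|}{2|[SK]|}\Big)P(|\theta|)+3\Big(1-\frac{[EK][V]^{1/2}|\theta|}{|[SK]|}\Big)=0,$$ where $$P(|\theta|)=\big(|[SK]|[V]^{1/2}|\theta|-3\big)+D^{1/2}(|\theta|),$$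 $$D(|\theta|)=\big(|[SK]|[V]^{1/2}|\theta|-3\big)^2+\frac{4(2-c)\rho(1,n)\rho(3,n)}{(1-c)\rho(2,n)^2}|[SK]|[V]^{1/2}|\theta|.$$ -/

import Mathlib

open MeasureTheory ProbabilityTheory Filter Topology
open scoped NNReal

noncomputable section

/-- The three regulation recipes. -/
inductive RegulationType where
  | typeI
  | typeII
  | typeIII

/-- The upper incomplete gamma function `Γ(n, x)`. -/
def upperGamma (n x : ℝ) : ℝ := ∫ y in Set.Ioi x, y ^ (n - 1) * Real.exp (-y)

/-- The type-I kernel `1 - Γ(n, -log s) / Γ(n)` (for degree `n > 0`). -/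
def kernelI (n s : ℝ) : ℝ := 1 - upperGamma n (-Real.log s) / Real.Gamma n

/-- The cumulant reduction coefficients `ρ(m, n)`, for `m ≥ 1` and `n ≥ 0`.  At `n = 0` there is no
regulation, and every coefficient is `1`. -/
def rho : RegulationType → ℕ → ℝ → ℝ
  | .typeI, m, n => if n = 0 then 1 else ∫ s in (0 : ℝ)..1, kernelI n s ^ m
  | .typeII, m, n => 1 / ((m : ℝ) + 1) ^ n
  | .typeIII, m, n => 1 / ((m * n + 1) * Real.Gamma (n + 1) ^ m)

/-- A Lévy subordinator: independent stationary increments and, almost surely, nondecreasing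
right-continuous paths started at `0`. -/
structure IsSubordinator {Ω : Type*} [MeasurableSpace Ω] (X : ℝ≥0 → Ω → ℝ) (P : Measure Ω) :
    Prop where
  measurable : ∀ t, Measurable (X t)
  indep : HasIndepIncrements X P
  stationary : ∀ s t, IdentDistrib (fun ω => X (s + t) ω - X s ω) (X t) P P
  paths : ∀ᵐ ω ∂P, X 0 ω = 0 ∧ Monotone (fun t => X t ω) ∧
    ∀ t, ContinuousWithinAt (fun r => X r ω) (Set.Ici t) t

/-- The logarithm of the Laplace transform at time `1` of the tempered stable subordinator with
shape `a`, rate `b` and family parameter `c`. -/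
def temperedStableLogLT (a b c u : ℝ) : ℝ :=
  if c = 0 then -a * Real.log (u / b + 1)
  else a * Real.Gamma (-c) * ((u + b) ^ c - b ^ c)

/-- A tempered stable subordinator: a Lévy subordinator with
`E exp (-u X_t) = exp (t * temperedStableLogLT a b c u)` for `u > -b`. -/
structure IsTemperedStableSubordinator {Ω : Type*} [MeasurableSpace Ω] (a b c : ℝ)
    (X : ℝ≥0 → Ω → ℝ) (P : Measure Ω) : Prop extends IsSubordinator X P where
  laplace : ∀ (t : ℝ≥0) (u : ℝ), -b < u →
    ∫ ω, Real.exp (-u * X t ω) ∂P = Real.exp (t * temperedStableLogLT a b c u)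

/-- The pathwise integral `∫₀ᵗ X_s ds`. -/
def pathIntegral {Ω : Type*} (X : ℝ≥0 → Ω → ℝ) : ℝ≥0 → Ω → ℝ :=
  fun t ω => ∫ s in (0 : ℝ)..t, X s.toNNReal ω

/-- The running average `(1 / t) ∫₀ᵗ X_s ds`, equal to `0` at `t = 0`. -/
def runningAverage {Ω : Type*} (X : ℝ≥0 → Ω → ℝ) : ℝ≥0 → Ω → ℝ :=
  fun t ω => (1 / (t : ℝ)) * pathIntegral X t ω

/-- Clocks obtained from `X` by regulation of integer degree.  For degree `0` the clock is `X`.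
For degree `n ≥ 1` it is a Lévy subordinator `T` such that each `T_t` has the law of

* type I: the `n`-fold running average of `X` at time `t`;
* type II: the running average at time `t` of a type-II clock of degree `n - 1`;
* type III: the `n`-fold iterated integral of `X` up to time `t`, divided by `t ^ n`. -/
def IsAverageInducedClock {Ω : Type*} [MeasurableSpace Ω] (P : Measure Ω)
    (X : ℝ≥0 → Ω → ℝ) : RegulationType → ℕ → (ℝ≥0 → Ω → ℝ) → Prop
  | _, 0, T => T = X
  | .typeI, k + 1, T => IsSubordinator T P ∧
      ∀ t, IdentDistrib (T t) ((runningAverage^[k + 1] X) t) P P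
  | .typeII, k + 1, T => IsSubordinator T P ∧
      ∃ Y : ℝ≥0 → Ω → ℝ, IsAverageInducedClock P X .typeII k Y ∧
        ∀ t, IdentDistrib (T t) (runningAverage Y t) P P
  | .typeIII, k + 1, T => IsSubordinator T P ∧
      ∀ t, IdentDistrib (T t)
        (fun ω => (1 / (t : ℝ) ^ (k + 1)) * (pathIntegral^[k + 1] X) t ω) P P

/-- The logarithm of the Laplace transform, at time `1` and argument `u`, of the clock obtained from
`X` by regulation of real degree `n > 0`.  Here `cgf (X 1) P (-w)` is the logarithm of
`E exp (-w X_1)`. -/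
def regulatedLogLT {Ω : Type*} [MeasurableSpace Ω] (P : Measure Ω) (X : ℝ≥0 → Ω → ℝ) :
    RegulationType → ℝ → ℝ → ℝ
  | .typeI, n, u => ∫ s in (0 : ℝ)..1, cgf (X 1) P (-(kernelI n s * u))
  | .typeII, n, u => (1 / Real.Gamma n) *
      ∫ v in (0 : ℝ)..1, (-Real.log v) ^ (n - 1) * cgf (X 1) P (-(u * v))
  | .typeIII, n, u => ∫ s in (0 : ℝ)..1, cgf (X 1) P (-(s ^ n * u / Real.Gamma (n + 1)))

/-- `T` is a regulated `X`-clock of real degree `n ≥ 0`: either `n` is an integer and `T` is induced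
by repeated averaging, or `n > 0` and `T` is the Lévy subordinator with the Laplace transforms
that extend the averaging recipes to real degrees (for `u ≥ 0` and for `u` near the origin). -/
def IsRegulatedClock {Ω : Type*} [MeasurableSpace Ω] (P : Measure Ω) (X : ℝ≥0 → Ω → ℝ)
    (kind : RegulationType) (n : ℝ) (T : ℝ≥0 → Ω → ℝ) : Prop :=
  (∃ k : ℕ, n = k ∧ IsAverageInducedClock P X kind k T) ∨
  (0 < n ∧ IsSubordinator T P ∧
    ∀ t : ℝ≥0,
      (∀ u : ℝ, 0 ≤ u →
        ∫ ω, Real.exp (-u * T t ω) ∂P = Real.exp (t * regulatedLogLT P X kind n u)) ∧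
      (∀ᶠ u in 𝓝 (0 : ℝ),
        ∫ ω, Real.exp (-u * T t ω) ∂P = Real.exp (t * regulatedLogLT P X kind n u)))

/-- The Gaussian mixture `Ξ_t = μ t + θ T_t + W_{T_t}` on the clock `T`. -/
def gaussianMixture {Ω : Type*} (μ θ : ℝ) (T W : ℝ≥0 → Ω → ℝ) : ℝ≥0 → Ω → ℝ :=
  fun t ω => μ * t + θ * T t ω + W (T t ω).toNNReal ω

/-- The `m`-th cumulant of a random variable. -/
def cumulant {Ω : Type*} [MeasurableSpace Ω] (P : Measure Ω) (ξ : Ω → ℝ) (m : ℕ) : ℝ :=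
  iteratedDeriv m (cgf ξ P) 0

/-- The four moment conditions for a model variable `ξ`, given sample mean `M`, variance `V`,
skewness `SK` and excess kurtosis `EK`. -/
def MomentConditions {Ω : Type*} [MeasurableSpace Ω] (P : Measure Ω) (ξ : Ω → ℝ)
    (M V SK EK : ℝ) : Prop :=
  cumulant P ξ 1 = M ∧
  cumulant P ξ 2 = V ∧
  cumulant P ξ 3 = SK * V ^ (3 / 2 : ℝ) ∧
  cumulant P ξ 3 / cumulant P ξ 4 = SK / (EK * V ^ (1 / 2 : ℝ))

/-- The function `D(|θ|)`, with `x` in place of `|θ|`. -/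
def discriminantD (kind : RegulationType) (n c V SK x : ℝ) : ℝ :=
  (|SK| * V ^ (1 / 2 : ℝ) * x - 3) ^ 2 +
    4 * (2 - c) * rho kind 1 n * rho kind 3 n / ((1 - c) * rho kind 2 n ^ 2) *
      (|SK| * V ^ (1 / 2 : ℝ) * x)

/-- The function `P(|θ|)`, with `x` in place of `|θ|`. -/
def rootP (kind : RegulationType) (n c V SK x : ℝ) : ℝ :=
  (|SK| * V ^ (1 / 2 : ℝ) * x - 3) + Real.sqrt (discriminantD kind n c V SK x)

end

/-! Everything is read off from cumulant generating functions near `0`. Let `ψ` be the cumulant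
generating function of `X 1`. It is smooth on `(-b, b)`, and its derivatives at `0` are explicit.

Clock: near `0`, the cumulant generating function of `T Δ` is `Δ` times a mixture of dilations `∫ ψ
(z * g s) dν(s)`. Its `m`-th derivative at `0` is therefore the `m`-th moment of `g` times that of
`ψ`, and this moment is `rho kind m n`. For real degree the mixture is part of the definition. For
integer degree an iterated average is a weighted integral `∫ w(u) X_{tu} du`. Summation by parts
makes it a limit of sums of independent increments with weights `∫_s^1 w`, whence the exponent `t ∫
ψ (z ∫_s^1 w) ds` (`IsSubordinator.mgf_integral_mul`). Fubini identifies the weights of iterated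
averages as powers of `-log u` (type I) and of `1 - u` (type III). Type II repeats the case `w = 1`.

Mixture: conditioning on the clock replaces the argument of its generating function by `θ z + z ^ 2
/ 2` (`mgf_gaussianMixture`). The value is positive near `0`, which gives integrability, and the
chain rule gives the first four cumulants.

Algebra (`moment_equations_iff`): put `A = a Γ(1-c) b^(c-1)` and `y = θ ^ 2 / b`. The variance
equation is linear in `A`, hence determines `a`, and the mean then determines `μ`. The third
cumulant is `θ` times a positive number, so `θ` has the sign of `SK`. Multiplied by `θ` and combined
with the variance, the skewness equation is a quadratic in `y` with roots of opposite sign, and its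
positive root is the formula for `b`. Substituting this root into the ratio of third to fourth
cumulant gives the equation for `|θ|`. -/

noncomputable section

/-! ### Towers of derivatives and differentiation under the integral sign -/

/-- `D m` is the `m`-th derivative of `D 0` on the interval `(-r, r)`, for every `m`. -/
def IsDerivTower (r : ℝ) (D : ℕ → ℝ → ℝ) : Prop :=
  ∀ m z, |z| < r → HasDerivAt (D m) (D (m + 1) z) z

theorem IsDerivTower.mono {r r' : ℝ} {D : ℕ → ℝ → ℝ} (h : IsDerivTower r D) (hr : r' ≤ r) :
    IsDerivTower r' D := fun m z hz => h m z (hz.trans_le hr)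

theorem IsDerivTower.continuousOn {r : ℝ} {D : ℕ → ℝ → ℝ} (h : IsDerivTower r D) (m : ℕ) :
    ContinuousOn (D m) (Set.Ioo (-r) r) := fun z hz =>
  (h m z (abs_lt.2 hz)).continuousAt.continuousWithinAt

/-- Nothing is known about `f` off `s`, so `f` is first replaced by `0` there; this changes the
composite only on a null set. -/
theorem ContinuousOn.aestronglyMeasurable_comp_of_ae_mem {α : Type*} [MeasurableSpace α]
    {ν : Measure α} {f : ℝ → ℝ} {s : Set ℝ} (hf : ContinuousOn f s) (hs : MeasurableSet s)
    {g : α → ℝ} (hg : AEMeasurable g ν) (hgs : ∀ᵐ x ∂ν, g x ∈ s) :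
    AEStronglyMeasurable (fun x => f (g x)) ν := by
  classical
  have h1 : Measurable (s.piecewise f (fun _ => 0)) :=
    hf.measurable_piecewise continuousOn_const hs
  refine (h1.comp_aemeasurable hg).aestronglyMeasurable.congr ?_
  filter_upwards [hgs] with x hx
  simp [Set.piecewise, hx]

/-- Differentiation under the integral sign for a mixture of dilations. -/
theorem IsDerivTower.integral_dilation {r C : ℝ} {D : ℕ → ℝ → ℝ} (h : IsDerivTower r D)
    (hC : 0 < C) {α : Type*} [MeasurableSpace α] {ν : Measure α} {v g : α → ℝ}
    (hv : Integrable v ν) (hg : AEMeasurable g ν) (hgC : ∀ᵐ s ∂ν, |g s| ≤ C) :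
    IsDerivTower (r / C) (fun m z => ∫ s, v s * g s ^ m * D m (z * g s) ∂ν) := by
  intro m z₀ hz₀
  -- For `|z| ≤ ρ` all arguments `z * g s` lie in the compact interval `[-ρ C, ρ C]` inside `(-r,
  -- r)`, where each `D j` is bounded; this supplies the dominating function.
  obtain ⟨ρ, hρ1, hρ2⟩ := exists_between hz₀
  have hρr : ρ * C < r := by rwa [lt_div_iff₀ hC] at hρ2
  have hball : ∀ z : ℝ, |z| ≤ ρ → ∀ᵐ s ∂ν, z * g s ∈ Set.Icc (-(ρ * C)) (ρ * C) := by
    intro z hz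
    filter_upwards [hgC] with s hs
    rw [Set.mem_Icc, ← abs_le, abs_mul]
    exact mul_le_mul hz hs (abs_nonneg _) ((abs_nonneg _).trans hz)
  have hsub : Set.Icc (-(ρ * C)) (ρ * C) ⊆ Set.Ioo (-r) r := fun x hx =>
    ⟨by linarith [hx.1], by linarith [hx.2]⟩
  have hmeas : ∀ k j : ℕ, ∀ z : ℝ, |z| ≤ ρ →
      AEStronglyMeasurable (fun s => v s * g s ^ k * D j (z * g s)) ν := by
    intro k j z hz
    refine (hv.aestronglyMeasurable.mul (hg.pow_const k).aestronglyMeasurable).mul ?_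
    refine (h.continuousOn j).aestronglyMeasurable_comp_of_ae_mem measurableSet_Ioo
      (hg.const_mul z) ?_
    filter_upwards [hball z hz] with s hs using hsub hs
  have hbdd : ∀ j : ℕ, ∃ B : ℝ, ∀ x ∈ Set.Icc (-(ρ * C)) (ρ * C), ‖D j x‖ ≤ B := fun j =>
    isCompact_Icc.exists_bound_of_continuousOn ((h.continuousOn j).mono hsub)
  have hbound : ∀ k j : ℕ, ∃ B : ℝ, ∀ᵐ s ∂ν, ∀ z : ℝ, |z| ≤ ρ →
      ‖v s * g s ^ k * D j (z * g s)‖ ≤ |v s| * B := by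
    intro k j
    obtain ⟨B, hB⟩ := hbdd j
    refine ⟨C ^ k * B, ?_⟩
    filter_upwards [hgC] with s hs z hz
    have hmem : z * g s ∈ Set.Icc (-(ρ * C)) (ρ * C) := by
      rw [Set.mem_Icc, ← abs_le, abs_mul]
      exact mul_le_mul hz hs (abs_nonneg _) ((abs_nonneg _).trans hz)
    have h1 := hB _ hmem
    rw [norm_mul, norm_mul, norm_pow, Real.norm_eq_abs, Real.norm_eq_abs, mul_assoc]
    gcongr
  obtain ⟨B₀, hB₀⟩ := hbound m m
  obtain ⟨B₁, hB₁⟩ := hbound (m + 1) (m + 1)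
  refine (hasDerivAt_integral_of_dominated_loc_of_deriv_le (s := Set.Ioo (-ρ) ρ)
    (F := fun z s => v s * g s ^ m * D m (z * g s))
    (F' := fun z s => v s * g s ^ (m + 1) * D (m + 1) (z * g s))
    (bound := fun s => |v s| * B₁) (Ioo_mem_nhds (abs_lt.1 hρ1).1 (abs_lt.1 hρ1).2)
    ?_ ?_ (hmeas _ _ _ hρ1.le) ?_ (hv.abs.mul_const _) ?_).2
  · filter_upwards [Ioo_mem_nhds (abs_lt.1 hρ1).1 (abs_lt.1 hρ1).2] with z hz
    exact hmeas _ _ _ (abs_lt.2 hz).le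
  · refine (hv.abs.mul_const B₀).mono' (hmeas _ _ _ hρ1.le) ?_
    filter_upwards [hB₀] with s hs using hs _ hρ1.le
  · filter_upwards [hB₁] with s hs z hz using hs z (abs_lt.2 hz).le
  · filter_upwards [hgC] with s hs z hz
    have hmem : |z * g s| < r := by
      rw [abs_mul]
      exact (mul_le_mul (abs_lt.2 hz).le hs (abs_nonneg _)
        ((abs_nonneg _).trans (abs_lt.2 hz).le)).trans_lt hρr
    have h1 : HasDerivAt (fun z => z * g s) (g s) z := by
      simpa using (hasDerivAt_id z).mul_const (g s)
    have h2 := ((h m _ hmem).comp z h1).const_mul (v s * g s ^ m)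
    refine h2.congr_deriv ?_
    ring

/-! ### Derivatives for the tempered stable law -/

/-- The derivatives of the cumulant generating function of a tempered stable law. -/
def temperedStableTower (a b c : ℝ) : ℕ → ℝ → ℝ
  | 0, z => temperedStableLogLT a b c (-z)
  | m + 1, z => a * Real.Gamma ((m + 1 : ℕ) - c) * (b - z) ^ (c - (m + 1 : ℕ))

/-- Each differentiation produces a factor absorbed by `Γ(x + 1) = x Γ(x)`. From the first
derivative on, one formula covers both the logarithmic case `c = 0` and the power case; only order
`0` needs the split. -/
theorem isDerivTower_temperedStableTower {a b c : ℝ} (hb : 0 < b) (hc0 : 0 ≤ c) (hc1 : c < 1) :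
    IsDerivTower b (temperedStableTower a b c) := by
  intro m z hz
  have hbz : 0 < b - z := by linarith [(abs_lt.1 hz).2]
  have hsub : HasDerivAt (fun z => b - z) (-1) z := by
    simpa using (hasDerivAt_id z).const_sub b
  cases m with
  | zero =>
    by_cases hc : c = 0
    · subst hc
      have h1 : HasDerivAt (fun z : ℝ => -z / b + 1) (-1 / b) z :=
        ((hasDerivAt_id z).neg.div_const b).add_const 1
      have hpos : -z / b + 1 ≠ 0 := by
        have : -z / b + 1 = (b - z) / b := by field_simp; ring
        rw [this]; positivity
      have h2 := (h1.log hpos).const_mul (-a)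
      have h3 : temperedStableTower a b 0 0 = fun z => -a * Real.log (-z / b + 1) := by
        funext z; simp [temperedStableTower, temperedStableLogLT]
      rw [h3]
      refine h2.congr_deriv ?_
      have : -z / b + 1 = (b - z) / b := by field_simp; ring
      rw [this]
      simp [temperedStableTower, Real.rpow_neg_one]
      field_simp
    · have h3 : temperedStableTower a b c 0 =
          fun z => a * Real.Gamma (-c) * ((b - z) ^ c - b ^ c) := by
        funext z
        simp only [temperedStableTower, temperedStableLogLT, if_neg hc]
        rw [show -z + b = b - z by ring]
      rw [h3]
      have h2 := ((hsub.rpow_const (p := c) (Or.inl hbz.ne')).sub_const (b ^ c)).const_mul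
        (a * Real.Gamma (-c))
      refine h2.congr_deriv ?_
      have hG : Real.Gamma (1 - c) = -c * Real.Gamma (-c) := by
        rw [← Real.Gamma_add_one (neg_ne_zero.2 hc)]; congr 1; ring
      simp only [temperedStableTower, zero_add, Nat.cast_one]
      rw [hG]; ring
  | succ m =>
    have h2 := (hsub.rpow_const (p := c - (m + 1 : ℕ)) (Or.inl hbz.ne')).const_mul
        (a * Real.Gamma ((m + 1 : ℕ) - c))
    refine h2.congr_deriv ?_
    have hne : ((m + 1 : ℕ) : ℝ) - c ≠ 0 := by
      push_cast
      have : (0 : ℝ) ≤ m := Nat.cast_nonneg m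
      linarith
    have hG : Real.Gamma ((m + 1 + 1 : ℕ) - c) =
        ((m + 1 : ℕ) - c) * Real.Gamma ((m + 1 : ℕ) - c) := by
      rw [← Real.Gamma_add_one hne]; congr 1; push_cast; ring
    simp only [temperedStableTower]
    rw [hG, show c - ((m + 1 + 1 : ℕ) : ℝ) = c - (m + 1 : ℕ) - 1 by push_cast; ring]
    ring

/-! ### Conditioning on the clock -/

/-- The value at time `t` of a path known only at the times `k / (N + 1)`, as a limit along
approximations of `t` from the right. -/
def limitEval (t : ℝ) (w : ℕ × ℕ → ℝ) : ℝ :=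
  limsup (fun N : ℕ => w (N, ⌈t * (N + 1)⌉₊)) atTop

/-- A limsup is defined for every `w`, unlike a limit, and preserves measurability. The index
depends on `t` only through a natural number, so countability gives joint measurability. -/
theorem measurable_limitEval : Measurable (fun p : ℝ × (ℕ × ℕ → ℝ) => limitEval p.1 p.2) := by
  refine Measurable.limsup fun N => ?_
  have h1 : Measurable (fun q : (ℕ × ℕ → ℝ) × ℕ => q.1 (N, q.2)) :=
    measurable_from_prod_countable_left fun k => measurable_pi_apply (N, k)
  have h2 : Measurable (fun p : ℝ × (ℕ × ℕ → ℝ) => (p.2, ⌈p.1 * ((N : ℝ) + 1)⌉₊)) :=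
    measurable_snd.prodMk (Nat.measurable_ceil.comp (measurable_fst.mul_const _))
  exact h1.comp h2

/-- The restriction of a path to the times `k / (N + 1)`. -/
def gridRestrict (f : ℝ≥0 → ℝ) : ℕ × ℕ → ℝ := fun p => f (p.2 / (p.1 + 1))

theorem tendsto_natCeil_mul_div (t : ℝ) :
    Tendsto (fun N : ℕ => (⌈t * (N + 1)⌉₊ : ℝ≥0) / (N + 1)) atTop (𝓝 t.toNNReal) := by
  rw [← NNReal.tendsto_coe]
  have h1 : Tendsto (fun N : ℕ => (1 : ℝ) / (N + 1)) atTop (𝓝 0) :=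
    tendsto_one_div_add_atTop_nhds_zero_nat
  have h2 : Tendsto (fun N : ℕ => (t.toNNReal : ℝ) + 1 / ((N : ℝ) + 1)) atTop
      (𝓝 (t.toNNReal : ℝ)) := by simpa using h1.const_add (t.toNNReal : ℝ)
  refine tendsto_of_tendsto_of_tendsto_of_le_of_le tendsto_const_nhds h2 ?_ ?_
  · intro N
    have hN : (0 : ℝ) < N + 1 := by positivity
    simp only [Real.coe_toNNReal', NNReal.coe_div, NNReal.coe_natCast, NNReal.coe_add,
      NNReal.coe_one]
    rw [le_div_iff₀ hN]
    rcases le_total t 0 with ht | ht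
    · rw [max_eq_right ht, zero_mul]; exact Nat.cast_nonneg _
    · rw [max_eq_left ht]; exact Nat.le_ceil _
  · intro N
    have hN : (0 : ℝ) < N + 1 := by positivity
    simp only [Real.coe_toNNReal', NNReal.coe_div, NNReal.coe_natCast, NNReal.coe_add,
      NNReal.coe_one]
    rw [div_le_iff₀ hN, add_mul, one_div_mul_cancel hN.ne']
    rcases le_total t 0 with ht | ht
    · rw [max_eq_right ht, Nat.ceil_eq_zero.2 (mul_nonpos_of_nonpos_of_nonneg ht hN.le)]
      simp
    · rw [max_eq_left ht]; exact (Nat.ceil_lt_add_one (by positivity)).le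

theorem limitEval_gridRestrict {f : ℝ≥0 → ℝ} (hf : Continuous f) (t : ℝ) :
    limitEval t (gridRestrict f) = f t.toNNReal :=
  ((hf.tendsto _).comp (tendsto_natCeil_mul_div t)).limsup_eq

theorem measurable_gridRestrict : Measurable gridRestrict :=
  measurable_pi_lambda _ fun _ => measurable_pi_apply _

section Mixture

variable {Ω : Type*} [MeasurableSpace Ω] {P : Measure Ω}
  {T W : ℝ≥0 → Ω → ℝ}

theorem aemeasurable_gridRestrict (hW : IsBrownianReal W P) :
    AEMeasurable (fun ω => gridRestrict (fun t => W t ω)) P :=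
  aemeasurable_pi_lambda _ fun _ => hW.aemeasurable _

/-- Joint measurability of `(t, ω) ↦ W t ω` is not given. On the almost sure event of continuous
paths, `W` at the random time is a measurable functional of the clock and of countably many
coordinates of `W`. -/
theorem gaussianMixture_ae_eq (hW : IsBrownianReal W P) (μ θ : ℝ) (Δ : ℝ≥0) :
    gaussianMixture μ θ T W Δ =ᵐ[P] fun ω => μ * Δ + θ * T Δ ω +
      limitEval (T Δ ω) (gridRestrict fun t => W t ω) := by
  filter_upwards [hW.cont] with ω hω
  rw [limitEval_gridRestrict hω]
  rfl

theorem lintegral_exp_mul_brownian (hW : IsBrownianReal W P) (z : ℝ) (t : ℝ≥0) :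
    ∫⁻ ω, ENNReal.ofReal (Real.exp (z * W t ω)) ∂P =
      ENNReal.ofReal (Real.exp (z ^ 2 / 2 * t)) := by
  have h1 : mgf (W t) P z = Real.exp (z ^ 2 / 2 * t) := by
    rw [mgf_gaussianReal (hW.hasLaw_eval t).map_eq]
    congr 1; ring
  have hint : Integrable (fun ω => Real.exp (z * W t ω)) P := by
    by_contra h
    have := integral_undef h
    rw [mgf] at h1
    rw [h1] at this
    exact (Real.exp_pos _).ne' this
  rw [← ofReal_integral_eq_lintegral_ofReal hint (ae_of_all _ fun _ => (Real.exp_pos _).le)]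
  rw [← h1]
  rfl

theorem lintegral_exp_mul_limitEval (hW : IsBrownianReal W P) (θ z : ℝ) {t : ℝ} (ht : 0 ≤ t) :
    ∫⁻ ω, ENNReal.ofReal (Real.exp (z * (θ * t + limitEval t (gridRestrict fun s => W s ω)))) ∂P =
      ENNReal.ofReal (Real.exp ((θ * z + z ^ 2 / 2) * t)) := by
  have h1 : ∀ᵐ ω ∂P, ENNReal.ofReal (Real.exp (z * (θ * t +
      limitEval t (gridRestrict fun s => W s ω)))) =
      ENNReal.ofReal (Real.exp (θ * z * t)) *
        ENNReal.ofReal (Real.exp (z * W t.toNNReal ω)) := by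
    filter_upwards [hW.cont] with ω hω
    rw [limitEval_gridRestrict hω, ← ENNReal.ofReal_mul (Real.exp_pos _).le, ← Real.exp_add]
    congr 2; ring
  rw [lintegral_congr_ae h1, lintegral_const_mul' _ _ ENNReal.ofReal_ne_top,
    lintegral_exp_mul_brownian hW, ← ENNReal.ofReal_mul (Real.exp_pos _).le, ← Real.exp_add,
    Real.coe_toNNReal _ ht]
  congr 2; ring

/-- Independence makes the joint law of clock and grid values a product, so one may integrate over
`W` with the clock frozen at `t ≥ 0`. Lower integrals make this valid for every `z`, infinite values
included. -/
theorem lintegral_exp_clock_brownian [IsProbabilityMeasure P] {τ : Ω → ℝ} (hτ : AEMeasurable τ P)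
    (hτ0 : ∀ᵐ ω ∂P, 0 ≤ τ ω) (hW : IsBrownianReal W P)
    (hind : IndepFun τ (fun ω => gridRestrict (fun t => W t ω)) P) (θ z : ℝ) :
    ∫⁻ ω, ENNReal.ofReal (Real.exp (z * (θ * τ ω +
      limitEval (τ ω) (gridRestrict fun t => W t ω)))) ∂P =
      ∫⁻ ω, ENNReal.ofReal (Real.exp ((θ * z + z ^ 2 / 2) * τ ω)) ∂P := by
  set g : Ω → ℕ × ℕ → ℝ := fun ω => gridRestrict (fun t => W t ω) with hgdef
  have hg : AEMeasurable g P := aemeasurable_gridRestrict hW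
  have hmap := (indepFun_iff_map_prod_eq_prod_map_map hτ hg).1 hind
  set F : ℝ × (ℕ × ℕ → ℝ) → ENNReal := fun p =>
    ENNReal.ofReal (Real.exp (z * (θ * p.1 + limitEval p.1 p.2))) with hFdef
  have hF : Measurable F :=
    (Real.measurable_exp.comp (((measurable_fst.const_mul θ).add
      measurable_limitEval).const_mul z)).ennreal_ofReal
  have : IsProbabilityMeasure (P.map τ) := Measure.isProbabilityMeasure_map hτ
  have : IsProbabilityMeasure (P.map g) := Measure.isProbabilityMeasure_map hg
  calc ∫⁻ ω, F (τ ω, g ω) ∂P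
      = ∫⁻ p, F p ∂(P.map fun ω => (τ ω, g ω)) :=
        (lintegral_map' hF.aemeasurable (hτ.prodMk hg)).symm
    _ = ∫⁻ t, ∫⁻ w, F (t, w) ∂(P.map g) ∂(P.map τ) := by
        rw [hmap, lintegral_prod _ hF.aemeasurable]
    _ = ∫⁻ t, ENNReal.ofReal (Real.exp ((θ * z + z ^ 2 / 2) * t)) ∂(P.map τ) := by
        refine lintegral_congr_ae ?_
        filter_upwards [(ae_map_iff hτ measurableSet_Ici).2 hτ0] with t ht
        rw [lintegral_map' (f := fun w => F (t, w))
          (hF.comp measurable_prodMk_left).aemeasurable hg]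
        exact lintegral_exp_mul_limitEval hW θ z ht
    _ = _ := lintegral_map' (f := fun t => ENNReal.ofReal (Real.exp ((θ * z + z ^ 2 / 2) * t)))
        (by fun_prop) hτ

/-- The moment generating function of a Gaussian mixture, obtained by conditioning on the
clock. -/
theorem mgf_gaussianMixture [IsProbabilityMeasure P] {Δ : ℝ≥0} (hT : AEMeasurable (T Δ) P)
    (hT0 : ∀ᵐ ω ∂P, 0 ≤ T Δ ω) (hW : IsBrownianReal W P)
    (hTW : IndepFun (fun ω t => T t ω) (fun ω t => W t ω) P) (μ θ z : ℝ) :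
    mgf (gaussianMixture μ θ T W Δ) P z =
      Real.exp (z * (μ * Δ)) * mgf (T Δ) P (θ * z + z ^ 2 / 2) := by
  have hind : IndepFun (T Δ) (fun ω => gridRestrict (fun t => W t ω)) P :=
    hTW.comp (φ := fun f : ℝ≥0 → ℝ => f Δ) (ψ := gridRestrict) (measurable_pi_apply Δ)
      measurable_gridRestrict
  have hmeasL : AEMeasurable (fun ω => limitEval (T Δ ω) (gridRestrict fun t => W t ω)) P :=
    Measurable.comp_aemeasurable (g := fun p : ℝ × (ℕ × ℕ → ℝ) => limitEval p.1 p.2)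
      (f := fun ω => (T Δ ω, gridRestrict fun t => W t ω)) measurable_limitEval
      (hT.prodMk (aemeasurable_gridRestrict hW))
  have h1 : mgf (gaussianMixture μ θ T W Δ) P z =
      Real.exp (z * (μ * Δ)) * ∫ ω, Real.exp (z * (θ * T Δ ω +
        limitEval (T Δ ω) (gridRestrict fun t => W t ω))) ∂P := by
    rw [mgf, ← integral_const_mul]
    refine integral_congr_ae ?_
    filter_upwards [gaussianMixture_ae_eq (T := T) hW μ θ Δ] with ω hω
    rw [hω, ← Real.exp_add]
    congr 1; ring
  have h2 : AEStronglyMeasurable (fun ω => Real.exp (z * (θ * T Δ ω +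
      limitEval (T Δ ω) (gridRestrict fun t => W t ω)))) P :=
    (((hT.const_mul θ).add hmeasL).const_mul z).exp.aestronglyMeasurable
  have h3 : AEStronglyMeasurable (fun ω => Real.exp ((θ * z + z ^ 2 / 2) * T Δ ω)) P :=
    (hT.const_mul _).exp.aestronglyMeasurable
  -- No integrability is needed: both Bochner integrals are `toReal` of the same lower integral,
  -- hence both `0` when it is infinite.
  rw [h1, mgf, integral_eq_lintegral_of_nonneg_ae (ae_of_all _ fun _ => (Real.exp_pos _).le) h2,
    lintegral_exp_clock_brownian hT hT0 hW hind,
    integral_eq_lintegral_of_nonneg_ae (ae_of_all _ fun _ => (Real.exp_pos _).le) h3]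

end Mixture

/-! ### Cumulants of the mixture up to order four -/

theorem iteratedDeriv_eventuallyEq_of_hasDerivAt {f : ℝ → ℝ} {F : ℕ → ℝ → ℝ} {x : ℝ}
    (h0 : f =ᶠ[𝓝 x] F 0) (m : ℕ)
    (hF : ∀ k < m, ∀ᶠ z in 𝓝 x, HasDerivAt (F k) (F (k + 1) z) z) :
    iteratedDeriv m f =ᶠ[𝓝 x] F m := by
  induction m with
  | zero => simpa using h0
  | succ m ih =>
    have h1 := (ih fun k hk => hF k (hk.trans m.lt_succ_self)).deriv
    rw [iteratedDeriv_succ]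
    refine h1.trans ?_
    filter_upwards [hF m m.lt_succ_self] with z hz using hz.deriv

/-- The derivatives of `z ↦ ν z + δ ψ (θ z + z ^ 2 / 2)` up to order four, where `D` is the
sequence of derivatives of `ψ`. -/
def gaussianMixtureTower (ν δ θ : ℝ) (D : ℕ → ℝ → ℝ) : ℕ → ℝ → ℝ
  | 0, z => z * ν + δ * D 0 (θ * z + z ^ 2 / 2)
  | 1, z => ν + δ * (D 1 (θ * z + z ^ 2 / 2) * (θ + z))
  | 2, z => δ * (D 2 (θ * z + z ^ 2 / 2) * (θ + z) ^ 2 + D 1 (θ * z + z ^ 2 / 2))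
  | 3, z => δ * (D 3 (θ * z + z ^ 2 / 2) * (θ + z) ^ 3 +
      3 * (D 2 (θ * z + z ^ 2 / 2) * (θ + z)))
  | _, z => δ * (D 4 (θ * z + z ^ 2 / 2) * (θ + z) ^ 4 +
      6 * (D 3 (θ * z + z ^ 2 / 2) * (θ + z) ^ 2) + 3 * D 2 (θ * z + z ^ 2 / 2))

/-- The chain rule for `q(z) = θ z + z ^ 2 / 2`, with `q' = θ + z` and `q'' = 1`. The bound `k < 4`
matters: the last clause of `gaussianMixtureTower` serves every index from `4` on. -/
theorem hasDerivAt_gaussianMixtureTower {r ν δ θ : ℝ} {D : ℕ → ℝ → ℝ} (hD : IsDerivTower r D)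
    {z : ℝ} (hz : |θ * z + z ^ 2 / 2| < r) {k : ℕ} (hk : k < 4) :
    HasDerivAt (gaussianMixtureTower ν δ θ D k) (gaussianMixtureTower ν δ θ D (k + 1) z) z := by
  have hq : HasDerivAt (fun z : ℝ => θ * z + z ^ 2 / 2) (θ + z) z := by
    refine (((hasDerivAt_id z).const_mul θ).add
      (((hasDerivAt_id z).pow 2).div_const 2)).congr_deriv ?_
    simp
  have hl : HasDerivAt (fun z : ℝ => θ + z) 1 z := (hasDerivAt_id z).const_add θ
  have hc : ∀ j, HasDerivAt (fun z : ℝ => D j (θ * z + z ^ 2 / 2))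
      (D (j + 1) (θ * z + z ^ 2 / 2) * (θ + z)) z := fun j => (hD j _ hz).comp z hq
  interval_cases k
  · exact ((((hasDerivAt_id z).mul_const ν).add ((hc 0).const_mul δ))).congr_deriv
      (by simp [gaussianMixtureTower])
  · exact ((((hc 1).mul hl).const_mul δ).const_add ν).congr_deriv
      (by simp only [gaussianMixtureTower]; ring)
  · exact ((((hc 2).mul (hl.pow 2)).add (hc 1)).const_mul δ).congr_deriv
      (by simp only [gaussianMixtureTower, Pi.pow_apply]; ring)
  · exact ((((hc 3).mul (hl.pow 3)).add (((hc 2).mul hl).const_mul 3)).const_mul δ).congr_deriv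
      (by simp only [gaussianMixtureTower, Pi.pow_apply]; ring)

/-- The integral of a non-integrable function is `0` by convention, so a nonzero value certifies
finiteness. -/
theorem integrable_exp_mul_of_mgf_ne_zero {Ω : Type*} [MeasurableSpace Ω] {P : Measure Ω}
    {ξ : Ω → ℝ} {z : ℝ} (h : mgf ξ P z ≠ 0) : Integrable (fun ω => Real.exp (z * ξ ω)) P := by
  by_contra hn
  exact h (integral_undef hn)

theorem eventually_abs_lt_quadratic (θ : ℝ) {r : ℝ} (hr : 0 < r) :
    ∀ᶠ z in 𝓝 (0 : ℝ), |θ * z + z ^ 2 / 2| < r := by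
  have : Tendsto (fun z : ℝ => |θ * z + z ^ 2 / 2|) (𝓝 0) (𝓝 0) := by
    have h : Continuous (fun z : ℝ => |θ * z + z ^ 2 / 2|) := by fun_prop
    simpa using h.tendsto 0
  exact this.eventually_lt_const hr

section Cumulants

variable {Ω : Type*} [MeasurableSpace Ω] {P : Measure Ω} [IsProbabilityMeasure P]
  {T W : ℝ≥0 → Ω → ℝ} {Δ : ℝ≥0} {μ θ r : ℝ} {D : ℕ → ℝ → ℝ}

theorem eventually_mgf_gaussianMixture (hT : AEMeasurable (T Δ) P) (hT0 : ∀ᵐ ω ∂P, 0 ≤ T Δ ω)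
    (hW : IsBrownianReal W P) (hTW : IndepFun (fun ω t => T t ω) (fun ω t => W t ω) P)
    (hr : 0 < r) (hmgf : ∀ s, |s| < r → mgf (T Δ) P s = Real.exp (Δ * D 0 s)) :
    ∀ᶠ z in 𝓝 (0 : ℝ), mgf (gaussianMixture μ θ T W Δ) P z =
      Real.exp (gaussianMixtureTower (μ * Δ) Δ θ D 0 z) := by
  filter_upwards [eventually_abs_lt_quadratic θ hr] with z hz
  rw [mgf_gaussianMixture hT hT0 hW hTW, hmgf _ hz, ← Real.exp_add]
  rfl

theorem zero_mem_interior_integrableExpSet_gaussianMixture (hT : AEMeasurable (T Δ) P)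
    (hT0 : ∀ᵐ ω ∂P, 0 ≤ T Δ ω)
    (hW : IsBrownianReal W P) (hTW : IndepFun (fun ω t => T t ω) (fun ω t => W t ω) P)
    (hr : 0 < r) (hmgf : ∀ s, |s| < r → mgf (T Δ) P s = Real.exp (Δ * D 0 s)) :
    0 ∈ interior (integrableExpSet (gaussianMixture μ θ T W Δ) P) := by
  rw [mem_interior_iff_mem_nhds]
  filter_upwards [eventually_mgf_gaussianMixture (μ := μ) (θ := θ) hT hT0 hW hTW hr hmgf]
    with z hz
  refine integrable_exp_mul_of_mgf_ne_zero ?_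
  rw [hz]
  exact (Real.exp_pos _).ne'

theorem cumulant_gaussianMixture (hT : AEMeasurable (T Δ) P)
    (hT0 : ∀ᵐ ω ∂P, 0 ≤ T Δ ω)
    (hW : IsBrownianReal W P) (hTW : IndepFun (fun ω t => T t ω) (fun ω t => W t ω) P)
    (hr : 0 < r) (hD : IsDerivTower r D)
    (hmgf : ∀ s, |s| < r → mgf (T Δ) P s = Real.exp (Δ * D 0 s)) {m : ℕ} (hm : m ≤ 4) :
    cumulant P (gaussianMixture μ θ T W Δ) m = gaussianMixtureTower (μ * Δ) Δ θ D m 0 := by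
  refine (iteratedDeriv_eventuallyEq_of_hasDerivAt ?_ m fun k hk => ?_).self_of_nhds
  · filter_upwards [eventually_mgf_gaussianMixture (μ := μ) (θ := θ) hT hT0 hW hTW hr hmgf]
      with z hz
    rw [cgf, hz, Real.log_exp]
  · filter_upwards [eventually_abs_lt_quadratic θ hr] with z hz
    exact hasDerivAt_gaussianMixtureTower hD hz (hk.trans_le hm)

end Cumulants

/-! ### Algebra of the moment equations -/

/-- The positive root of the quadratic equation satisfied by `θ ^ 2 / b`. -/
theorem quadratic_iff_root {c ρ₁ ρ₂ ρ₃ S y : ℝ} (hc : c < 1) (h1 : 0 < ρ₁) (h2 : 0 < ρ₂)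
    (h3 : 0 < ρ₃) (hS : 0 < S) (hy : 0 < y) :
    (1 - c) * (y * ((2 - c) * ρ₃ * y + 3 * ρ₂)) = S * (ρ₁ + (1 - c) * ρ₂ * y) ↔
      2 * (2 - c) * ρ₃ * y = ρ₂ * ((S - 3) +
        √((S - 3) ^ 2 + 4 * (2 - c) * ρ₁ * ρ₃ / ((1 - c) * ρ₂ ^ 2) * S)) := by
  have hc1 : 0 < 1 - c := by linarith
  have hc2 : 0 < 2 - c := by linarith
  set u := 2 * (2 - c) * ρ₃ * y / ρ₂ - (S - 3) with hu
  set D := (S - 3) ^ 2 + 4 * (2 - c) * ρ₁ * ρ₃ / ((1 - c) * ρ₂ ^ 2) * S with hD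
  have hD0 : 0 < D := by positivity
  have e1 : (2 * (2 - c) * ρ₃ * y = ρ₂ * ((S - 3) + √D)) ↔ √D = u := by
    rw [hu, eq_sub_iff_add_eq, eq_div_iff h2.ne']
    constructor <;> intro h <;> linarith
  -- Completing the square: the defect of the quadratic equation is a positive multiple of `u ^ 2 -
  -- D`.
  have e2 : u ^ 2 - D = 4 * (2 - c) * ρ₃ / ((1 - c) * ρ₂ ^ 2) *
      ((1 - c) * (y * ((2 - c) * ρ₃ * y + 3 * ρ₂)) - S * (ρ₁ + (1 - c) * ρ₂ * y)) := by
    rw [hu, hD]; field_simp; ring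
  rw [e1]
  constructor
  · intro h
    rw [h, sub_self, mul_zero, sub_eq_zero] at e2
    -- This selects the positive root: the equation reads `(1 - c) y ((2 - c) ρ₃ y - ρ₂ (S - 3)) = S
    -- ρ₁ > 0`.
    have hpos : 0 < u := by
      have h4 : 0 < (1 - c) * y * ((2 - c) * ρ₃ * y - ρ₂ * (S - 3)) := by
        have : (1 - c) * y * ((2 - c) * ρ₃ * y - ρ₂ * (S - 3)) = S * ρ₁ := by linarith
        rw [this]; positivity
      have h5 : 0 < (2 - c) * ρ₃ * y - ρ₂ * (S - 3) :=
        (mul_pos_iff_of_pos_left (by positivity)).1 h4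
      have h6 : 0 < (2 - c) * ρ₃ * y := by positivity
      rw [hu, sub_pos, lt_div_iff₀ h2]
      linarith
    rw [← e2, Real.sqrt_sq hpos.le]
  · intro h
    have h4 : u ^ 2 - D = 0 := by rw [← h, Real.sq_sqrt hD0.le, sub_self]
    rw [h4, zero_eq_mul, sub_eq_zero] at e2
    exact e2.resolve_left (by positivity)

/-- The moment conditions in terms of the parameters: `A` is the mean of the unregulated clock per
unit of time, `v ^ 2` the variance of the sample, and `y = θ ^ 2 / b`. -/
theorem moment_equations_iff {A b c ρ₁ ρ₂ ρ₃ ρ₄ μ θ δ v M SK EK Q : ℝ} (hA : 0 < A) (hb : 0 < b)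
    (hc : c < 1) (h1 : 0 < ρ₁) (h2 : 0 < ρ₂) (h3 : 0 < ρ₃) (h4 : 0 < ρ₄) (hδ : 0 < δ)
    (hv : 0 < v) (hSK : SK ≠ 0)
    (hQ : Q = (|SK| * v * |θ| - 3) + √((|SK| * v * |θ| - 3) ^ 2 +
      4 * (2 - c) * ρ₁ * ρ₃ / ((1 - c) * ρ₂ ^ 2) * (|SK| * v * |θ|))) :
    (μ * δ + δ * (ρ₁ * A * θ) = M ∧
      δ * (ρ₂ * ((1 - c) * A / b) * θ ^ 2 + ρ₁ * A) = v ^ 2 ∧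
      δ * (ρ₃ * ((2 - c) * (1 - c) * A / b ^ 2) * θ ^ 3 + 3 * (ρ₂ * ((1 - c) * A / b) * θ)) =
        SK * v ^ 3 ∧
      δ * (ρ₃ * ((2 - c) * (1 - c) * A / b ^ 2) * θ ^ 3 + 3 * (ρ₂ * ((1 - c) * A / b) * θ)) /
        (δ * (ρ₄ * ((3 - c) * (2 - c) * (1 - c) * A / b ^ 3) * θ ^ 4 +
          6 * (ρ₃ * ((2 - c) * (1 - c) * A / b ^ 2) * θ ^ 2) + 3 * (ρ₂ * ((1 - c) * A / b)))) =
        SK / (EK * v)) ↔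
    (b = 2 * (2 - c) * ρ₃ * θ ^ 2 / (ρ₂ * Q) ∧
      δ * A * (ρ₁ + (1 - c) * ρ₂ * θ ^ 2 / b) = v ^ 2 ∧
      μ = M / δ - ρ₁ * θ * v ^ 2 / (δ * (ρ₁ + (1 - c) * ρ₂ * θ ^ 2 / b)) ∧
      θ = Real.sign SK * |θ| ∧
      (3 - c) * ρ₂ * ρ₄ / (4 * (2 - c) * ρ₃ ^ 2) * Q ^ 2 +
        (3 - EK * v * |θ| / (2 * |SK|)) * Q + 3 * (1 - EK * v * |θ| / |SK|) = 0) := by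
  have hc1 : 0 < 1 - c := by linarith
  have hc2 : 0 < 2 - c := by linarith
  have hc3 : 0 < 3 - c := by linarith
  set y := θ ^ 2 / b with hy
  have hy0 : 0 ≤ y := by positivity
  have hθy : θ ^ 2 = y * b := by rw [hy]; field_simp
  have hHy : ρ₁ + (1 - c) * ρ₂ * θ ^ 2 / b = ρ₁ + (1 - c) * ρ₂ * y := by rw [hy]; ring
  rw [hHy]
  set H := ρ₁ + (1 - c) * ρ₂ * y with hH
  have hH0 : 0 < H := by positivity
  have e2 : δ * (ρ₂ * ((1 - c) * A / b) * θ ^ 2 + ρ₁ * A) = δ * A * H := by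
    rw [hH, hy]; ring
  have e3 : δ * (ρ₃ * ((2 - c) * (1 - c) * A / b ^ 2) * θ ^ 3 + 3 * (ρ₂ * ((1 - c) * A / b) * θ))
      = θ * (δ * A * (1 - c) / b * ((2 - c) * ρ₃ * y + 3 * ρ₂)) := by
    rw [hy]; field_simp
  have e4 : δ * (ρ₄ * ((3 - c) * (2 - c) * (1 - c) * A / b ^ 3) * θ ^ 4 +
          6 * (ρ₃ * ((2 - c) * (1 - c) * A / b ^ 2) * θ ^ 2) + 3 * (ρ₂ * ((1 - c) * A / b))) =
      δ * A * (1 - c) / b * ((3 - c) * (2 - c) * ρ₄ * y ^ 2 + 6 * (2 - c) * ρ₃ * y + 3 * ρ₂) := by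
    rw [hy]; field_simp
  rw [e2, e3, e4]
  set k := δ * A * (1 - c) / b with hk
  have hk0 : 0 < k := by positivity
  clear_value k
  have hL : 0 < (2 - c) * ρ₃ * y + 3 * ρ₂ := by positivity
  -- The third cumulant is `θ` times a positive number. If `θ` and `SK` do not have the same strict
  -- sign, both sides of the equivalence fail.
  by_cases hθS : 0 < θ * SK
  · have hθ : θ ≠ 0 := fun h => by simp [h] at hθS
    have hy1 : 0 < y := by positivity
    have habs : |θ| * |SK| = θ * SK := by rw [← abs_mul, abs_of_pos hθS]
    have hsign : θ = Real.sign SK * |θ| := by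
      rcases hSK.lt_or_gt with h | h
      · have : θ < 0 := by nlinarith
        rw [Real.sign_of_neg h, abs_of_neg this]; ring
      · have : 0 < θ := by nlinarith
        rw [Real.sign_of_pos h, abs_of_pos this]; ring
    have hratio : EK * v * |θ| / |SK| = EK * v * θ / SK := by
      have : |SK| ≠ 0 := abs_ne_zero.2 hSK
      rw [div_eq_div_iff this hSK]
      have hs : Real.sign SK * |SK| = SK := by
        rcases hSK.lt_or_gt with h | h
        · rw [Real.sign_of_neg h, abs_of_neg h]; ring
        · rw [Real.sign_of_pos h, abs_of_pos h]; ring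
      linear_combination (-EK * v * |SK|) * hsign - EK * v * |θ| * hs
    have hS : 0 < |SK| * v * |θ| := by positivity
    have hSe : |SK| * v * |θ| = θ * SK * v := by rw [← habs]; ring
    have hQ0 : 0 < Q := by
      rw [hQ]
      have : |(|SK| * v * |θ| - 3)| < √((|SK| * v * |θ| - 3) ^ 2 +
          4 * (2 - c) * ρ₁ * ρ₃ / ((1 - c) * ρ₂ ^ 2) * (|SK| * v * |θ|)) := by
        rw [← Real.sqrt_sq_eq_abs]
        refine Real.sqrt_lt_sqrt (sq_nonneg _) ?_
        have : 0 < 4 * (2 - c) * ρ₁ * ρ₃ / ((1 - c) * ρ₂ ^ 2) * (|SK| * v * |θ|) := by positivity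
        linarith
      linarith [neg_abs_le (|SK| * v * |θ| - 3)]
    have hroot := quadratic_iff_root hc h1 h2 h3 hS hy1
    rw [← hQ] at hroot
    have hbiff : b = 2 * (2 - c) * ρ₃ * θ ^ 2 / (ρ₂ * Q) ↔ 2 * (2 - c) * ρ₃ * y = ρ₂ * Q := by
      rw [eq_div_iff (by positivity), hθy]
      constructor
      · intro h
        have : b * (ρ₂ * Q) = b * (2 * (2 - c) * ρ₃ * y) := by rw [h]; ring
        exact (mul_left_cancel₀ hb.ne' this).symm
      · intro h
        rw [← h]; ring
    rw [hbiff, ← hroot, hSe]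
    -- Multiplying by `θ` turns `θ ^ 2 / b` into `y`, and replacing one `v ^ 2` by `δ A H` lets `δ
    -- A` cancel.
    have key3 : δ * A * H = v ^ 2 →
        (θ * (k * ((2 - c) * ρ₃ * y + 3 * ρ₂)) = SK * v ^ 3 ↔
          (1 - c) * (y * ((2 - c) * ρ₃ * y + 3 * ρ₂)) =
            θ * SK * v * (ρ₁ + (1 - c) * ρ₂ * y)) := by
      intro hV
      rw [← mul_right_inj' hθ, ← hH]
      have l1 : θ * (θ * (k * ((2 - c) * ρ₃ * y + 3 * ρ₂))) =
          δ * A * ((1 - c) * (y * ((2 - c) * ρ₃ * y + 3 * ρ₂))) := by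
        rw [hk, hy]; field_simp
      have l2 : θ * (SK * v ^ 3) = δ * A * (θ * SK * v * H) := by
        rw [show v ^ 3 = v * v ^ 2 by ring, ← hV]; ring
      rw [l1, l2, mul_right_inj' (by positivity)]
    have key1 : δ * A * H = v ^ 2 →
        (μ * δ + δ * (ρ₁ * A * θ) = M ↔ μ = M / δ - ρ₁ * θ * v ^ 2 / (δ * H)) := by
      intro hV
      have l1 : ρ₁ * θ * v ^ 2 / (δ * H) = ρ₁ * θ * A := by
        rw [← hV]; field_simp
      rw [l1, eq_sub_iff_add_eq, eq_div_iff hδ.ne']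
      constructor <;> intro h <;> linarith
    have key4 : 2 * (2 - c) * ρ₃ * y = ρ₂ * Q →
        (θ * (k * ((2 - c) * ρ₃ * y + 3 * ρ₂)) /
          (k * ((3 - c) * (2 - c) * ρ₄ * y ^ 2 + 6 * (2 - c) * ρ₃ * y + 3 * ρ₂)) =
            SK / (EK * v) ↔
        (3 - c) * ρ₂ * ρ₄ / (4 * (2 - c) * ρ₃ ^ 2) * Q ^ 2 +
        (3 - EK * v * |θ| / (2 * |SK|)) * Q + 3 * (1 - EK * v * |θ| / |SK|) = 0) := by
      intro hyQ
      have hN : 0 < (3 - c) * (2 - c) * ρ₄ * y ^ 2 + 6 * (2 - c) * ρ₃ * y + 3 * ρ₂ := by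
        positivity
      have hQy : Q = 2 * (2 - c) * ρ₃ * y / ρ₂ := by rw [hyQ]; field_simp
      have hhalf : EK * v * |θ| / (2 * |SK|) = EK * v * θ / SK / 2 := by
        rw [← hratio]; ring
      have l1 : ρ₂ * ((3 - c) * ρ₂ * ρ₄ / (4 * (2 - c) * ρ₃ ^ 2) * Q ^ 2 +
          (3 - EK * v * |θ| / (2 * |SK|)) * Q + 3 * (1 - EK * v * |θ| / |SK|)) =
          ((3 - c) * (2 - c) * ρ₄ * y ^ 2 + 6 * (2 - c) * ρ₃ * y + 3 * ρ₂) -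
            EK * v * θ / SK * ((2 - c) * ρ₃ * y + 3 * ρ₂) := by
        rw [hhalf, hratio, hQy]; field_simp; ring
      have l2 : (3 - c) * ρ₂ * ρ₄ / (4 * (2 - c) * ρ₃ ^ 2) * Q ^ 2 +
          (3 - EK * v * |θ| / (2 * |SK|)) * Q + 3 * (1 - EK * v * |θ| / |SK|) = 0 ↔
          (3 - c) * (2 - c) * ρ₄ * y ^ 2 + 6 * (2 - c) * ρ₃ * y + 3 * ρ₂ =
            EK * v * θ / SK * ((2 - c) * ρ₃ * y + 3 * ρ₂) := by
        rw [← sub_eq_zero (b := EK * v * θ / SK * _), ← l1, mul_eq_zero, or_iff_right h2.ne']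
      rw [l2]
      set N := (3 - c) * (2 - c) * ρ₄ * y ^ 2 + 6 * (2 - c) * ρ₃ * y + 3 * ρ₂
      set L := (2 - c) * ρ₃ * y + 3 * ρ₂
      -- For `EK = 0` the target ratio `SK / (0 * v)` is `0` by the division convention while the
      -- left side is nonzero. The polynomial equation fails too, since it reduces to `N = 0` with
      -- `N > 0`.
      by_cases hEK : EK = 0
      · subst hEK
        have : θ * (k * L) / (k * N) ≠ 0 := by positivity
        simp only [zero_mul, div_zero, zero_div]
        exact ⟨fun h => absurd h this, fun h => absurd h hN.ne'⟩
      · rw [div_eq_div_iff (by positivity) (by positivity), div_mul_eq_mul_div, eq_div_iff hSK]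
        constructor
        · intro h
          refine mul_left_cancel₀ hk0.ne' ?_
          linarith
        · intro h
          linear_combination (-k) * h
    constructor
    · rintro ⟨hM, hV, h3', h4'⟩
      have hq := (key3 hV).1 h3'
      rw [hSe] at hroot
      exact ⟨hq, hV, (key1 hV).1 hM, hsign, (key4 (hroot.1 hq)).1 h4'⟩
    · rintro ⟨hq, hV, hM, -, h4'⟩
      rw [hSe] at hroot
      exact ⟨(key1 hV).2 hM, hV, (key3 hV).2 hq, (key4 (hroot.1 hq)).2 h4'⟩
  · refine iff_of_false ?_ ?_
    · rintro ⟨-, -, h, -⟩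
      refine hθS ?_
      have h5 : θ * SK * (k * ((2 - c) * ρ₃ * y + 3 * ρ₂)) = SK ^ 2 * v ^ 3 := by
        linear_combination SK * h
      refine (mul_pos_iff_of_pos_right (mul_pos hk0 hL)).1 ?_
      rw [h5]; positivity
    · rintro ⟨h, -, -, hs, -⟩
      -- With `θ = 0` the formula for `b` would give `b = 0`.
      have hθ : θ ≠ 0 := by
        rintro rfl
        simp at h
        exact hb.ne' h
      refine hθS ?_
      rw [hs]
      have : 0 < |θ| := abs_pos.2 hθ
      rcases hSK.lt_or_gt with h' | h'
      · rw [Real.sign_of_neg h']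
        have := mul_pos this (neg_pos.2 h')
        linarith
      · rw [Real.sign_of_pos h']
        have := mul_pos this h'
        linarith

/-! ### The substitution `u = exp (-y)` and the type-I kernel -/

section ExpSubstitution

theorem image_exp_neg_Ioo {s : ℝ} (hs : 0 < s) :
    (fun y : ℝ => Real.exp (-y)) '' Set.Ioo 0 (-Real.log s) = Set.Ioo s 1 := by
  ext u
  constructor
  · rintro ⟨y, ⟨hy0, hy1⟩, rfl⟩
    exact ⟨by rw [← Real.log_lt_iff_lt_exp hs]; linarith, by rw [Real.exp_lt_one_iff]; linarith⟩
  · rintro ⟨h1, h2⟩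
    have hu : 0 < u := hs.trans h1
    refine ⟨-Real.log u, ⟨?_, ?_⟩, by simp [Real.exp_log hu]⟩
    · have := Real.log_neg hu h2; linarith
    · have := Real.log_lt_log hs h1; linarith

theorem image_exp_neg_Ioi :
    (fun y : ℝ => Real.exp (-y)) '' Set.Ioi 0 = Set.Ioo 0 1 := by
  ext u
  constructor
  · rintro ⟨y, hy0, rfl⟩
    exact ⟨Real.exp_pos _, by rw [Real.exp_lt_one_iff]; linarith [Set.mem_Ioi.1 hy0]⟩
  · rintro ⟨h1, h2⟩
    refine ⟨-Real.log u, ?_, by simp [Real.exp_log h1]⟩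
    have := Real.log_neg h1 h2
    exact Set.mem_Ioi.2 (by linarith)

theorem hasDerivWithinAt_exp_neg (S : Set ℝ) (y : ℝ) :
    HasDerivWithinAt (fun y : ℝ => Real.exp (-y)) (-Real.exp (-y)) S y := by
  have := (hasDerivAt_neg y).exp.hasDerivWithinAt (s := S)
  simpa using this

theorem injOn_exp_neg (S : Set ℝ) : Set.InjOn (fun y : ℝ => Real.exp (-y)) S :=
  fun _ _ _ _ h => neg_injective (Real.exp_injective h)

theorem integral_Ioo_eq_integral_exp_neg {s : ℝ} (hs : 0 < s) (g : ℝ → ℝ) :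
    ∫ u in Set.Ioo s 1, g u =
      ∫ y in Set.Ioo 0 (-Real.log s), Real.exp (-y) * g (Real.exp (-y)) := by
  rw [← image_exp_neg_Ioo hs, integral_image_eq_integral_abs_deriv_smul measurableSet_Ioo
    (fun x _ => hasDerivWithinAt_exp_neg _ x) (injOn_exp_neg _)]
  simp

theorem integral_Ioo_zero_one_eq_integral_exp_neg (g : ℝ → ℝ) :
    ∫ u in Set.Ioo 0 1, g u = ∫ y in Set.Ioi 0, Real.exp (-y) * g (Real.exp (-y)) := by
  rw [← image_exp_neg_Ioi, integral_image_eq_integral_abs_deriv_smul measurableSet_Ioi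
    (fun x _ => hasDerivWithinAt_exp_neg _ x) (injOn_exp_neg _)]
  simp

theorem integrableOn_Ioo_zero_one_iff_exp_neg (g : ℝ → ℝ) :
    IntegrableOn g (Set.Ioo 0 1) ↔
      IntegrableOn (fun y => Real.exp (-y) * g (Real.exp (-y))) (Set.Ioi 0) := by
  rw [← image_exp_neg_Ioi, integrableOn_image_iff_integrableOn_abs_deriv_smul measurableSet_Ioi
    (fun x _ => hasDerivWithinAt_exp_neg _ x) (injOn_exp_neg _)]
  simp

end ExpSubstitution

theorem integrableOn_neg_log_rpow {n : ℝ} (hn : 0 < n) :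
    IntegrableOn (fun u => (-Real.log u) ^ (n - 1)) (Set.Ioo 0 1) := by
  rw [integrableOn_Ioo_zero_one_iff_exp_neg]
  simpa using Real.GammaIntegral_convergent hn

/-- The substitution yields a gamma integral with rate `m + 1`. After division by `Γ(n)` this is the
type-II coefficient. -/
theorem integral_neg_log_rpow_mul_pow {n : ℝ} (hn : 0 < n) (m : ℕ) :
    ∫ u in Set.Ioo 0 1, (-Real.log u) ^ (n - 1) * u ^ m =
      Real.Gamma n / ((m : ℝ) + 1) ^ n := by
  rw [integral_Ioo_zero_one_eq_integral_exp_neg]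
  have hm : (0 : ℝ) < m + 1 := by positivity
  have h := Real.integral_rpow_mul_exp_neg_mul_Ioi hn hm
  rw [one_div, Real.inv_rpow hm.le, inv_mul_eq_div] at h
  rw [← h]
  refine setIntegral_congr_fun measurableSet_Ioi fun y _ => ?_
  simp only [Real.log_exp, neg_neg]
  rw [← Real.exp_nat_mul, mul_left_comm, ← Real.exp_add]
  congr 2; ring

section Kernel

variable {n : ℝ}

theorem integrableOn_rpow_mul_exp_neg (hn : 0 < n) :
    IntegrableOn (fun y : ℝ => y ^ (n - 1) * Real.exp (-y)) (Set.Ioi 0) := by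
  simpa only [mul_comm] using Real.GammaIntegral_convergent hn

theorem upperGamma_eq_sub (hn : 0 < n) {x : ℝ} (hx : 0 ≤ x) :
    upperGamma n x = Real.Gamma n - ∫ y in Set.Ioc 0 x, y ^ (n - 1) * Real.exp (-y) := by
  have h1 := integrableOn_rpow_mul_exp_neg hn
  have h2 : Real.Gamma n = ∫ y in Set.Ioi 0, y ^ (n - 1) * Real.exp (-y) := by
    rw [Real.Gamma_eq_integral hn]; simp only [mul_comm]
  rw [h2, ← Set.Ioc_union_Ioi_eq_Ioi hx, setIntegral_union Set.Ioc_disjoint_Ioi_same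
    measurableSet_Ioi (h1.mono_set Set.Ioc_subset_Ioi_self)
    (h1.mono_set (Set.Ioi_subset_Ioi hx)), upperGamma]
  ring

theorem kernelI_eq (hn : 0 < n) {s : ℝ} (hs0 : 0 < s) (hs1 : s ≤ 1) :
    kernelI n s = (∫ y in Set.Ioc 0 (-Real.log s), y ^ (n - 1) * Real.exp (-y)) /
      Real.Gamma n := by
  have hG := Real.Gamma_pos_of_pos hn
  rw [kernelI, upperGamma_eq_sub hn (by have := Real.log_nonpos hs0.le hs1; linarith)]
  field_simp
  ring

/-- Links the two descriptions of type I: the kernel in the real-degree formula is the tail integral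
of the averaging weight. -/
theorem kernelI_eq_integral_log (hn : 0 < n) {s : ℝ} (hs0 : 0 < s) (hs1 : s ≤ 1) :
    kernelI n s = (∫ u in s..1, (-Real.log u) ^ (n - 1)) / Real.Gamma n := by
  rw [kernelI_eq hn hs0 hs1, intervalIntegral.integral_of_le hs1, integral_Ioc_eq_integral_Ioo,
    integral_Ioc_eq_integral_Ioo, integral_Ioo_eq_integral_exp_neg hs0]
  simp only [Real.log_exp, neg_neg, mul_comm]

theorem kernelI_pos (hn : 0 < n) {s : ℝ} (hs0 : 0 < s) (hs1 : s < 1) : 0 < kernelI n s := by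
  rw [kernelI_eq hn hs0 hs1.le]
  have hx : 0 < -Real.log s := by have := Real.log_neg hs0 hs1; linarith
  refine div_pos ?_ (Real.Gamma_pos_of_pos hn)
  rw [← intervalIntegral.integral_of_le hx.le]
  refine intervalIntegral.intervalIntegral_pos_of_pos_on ?_ (fun y hy => ?_) hx
  · rw [intervalIntegrable_iff_integrableOn_Ioc_of_le hx.le]
    exact (integrableOn_rpow_mul_exp_neg hn).mono_set Set.Ioc_subset_Ioi_self
  · exact mul_pos (Real.rpow_pos_of_pos hy.1 _) (Real.exp_pos _)

theorem kernelI_le_one (hn : 0 < n) {s : ℝ} (hs0 : 0 < s) (hs1 : s ≤ 1) : kernelI n s ≤ 1 := by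
  have hx : 0 ≤ -Real.log s := by have := Real.log_nonpos hs0.le hs1; linarith
  have : 0 ≤ upperGamma n (-Real.log s) := setIntegral_nonneg measurableSet_Ioi fun y hy =>
    mul_nonneg (Real.rpow_nonneg (hx.trans (Set.mem_Ioi.1 hy).le) _) (Real.exp_pos _).le
  have h2 := div_nonneg this (Real.Gamma_pos_of_pos hn).le
  rw [kernelI]; linarith

/-- As `s` grows, a nonnegative integrand is integrated over a smaller interval. Monotonicity is
used to obtain measurability of the kernel. -/
theorem antitoneOn_kernelI (hn : 0 < n) : AntitoneOn (kernelI n) (Set.Ioo 0 1) := by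
  intro s hs t ht hst
  rw [kernelI_eq hn hs.1 hs.2.le, kernelI_eq hn ht.1 ht.2.le]
  refine div_le_div_of_nonneg_right ?_ (Real.Gamma_pos_of_pos hn).le
  refine setIntegral_mono_set
    ((integrableOn_rpow_mul_exp_neg hn).mono_set Set.Ioc_subset_Ioi_self) ?_ ?_
  · refine (ae_restrict_iff' measurableSet_Ioc).2 (ae_of_all _ fun y hy => ?_)
    exact mul_nonneg (Real.rpow_nonneg hy.1.le _) (Real.exp_pos _).le
  · refine (Set.Ioc_subset_Ioc_right ?_).eventuallyLE
    have := Real.log_le_log hs.1 hst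
    linarith

theorem aemeasurable_kernelI (hn : 0 < n) :
    AEMeasurable (kernelI n) (volume.restrict (Set.Ioo 0 1)) :=
  aemeasurable_restrict_of_antitoneOn measurableSet_Ioo (antitoneOn_kernelI hn)

theorem abs_kernelI_le_one (hn : 0 < n) :
    ∀ᵐ s ∂(volume.restrict (Set.Ioo (0 : ℝ) 1)), |kernelI n s| ≤ 1 :=
  (ae_restrict_iff' measurableSet_Ioo).2 (ae_of_all _ fun s hs => by
    rw [abs_of_pos (kernelI_pos hn hs.1 hs.2)]; exact kernelI_le_one hn hs.1 hs.2.le)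

theorem integrableOn_kernelI_pow (hn : 0 < n) (m : ℕ) :
    IntegrableOn (fun s => kernelI n s ^ m) (Set.Ioo 0 1) := by
  refine Integrable.mono' (g := fun _ => (1 : ℝ)) (by simp)
    ((aemeasurable_kernelI hn).pow_const m).aestronglyMeasurable ?_
  filter_upwards [abs_kernelI_le_one hn] with s hs
  rw [norm_pow]
  exact pow_le_one₀ (norm_nonneg _) hs

theorem rho_pos (kind : RegulationType) (m : ℕ) (hn : 0 ≤ n) : 0 < rho kind m n := by
  cases kind with
  | typeI =>
    rcases hn.eq_or_lt with h | h
    · simp [rho, ← h]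
    · simp only [rho, if_neg h.ne']
      refine intervalIntegral.intervalIntegral_pos_of_pos_on ?_
        (fun s hs => pow_pos (kernelI_pos h hs.1 hs.2) m) zero_lt_one
      rw [intervalIntegrable_iff_integrableOn_Ioo_of_le zero_le_one]
      exact integrableOn_kernelI_pow h m
  | typeII => simp only [rho]; positivity
  | typeIII =>
    have := Real.Gamma_pos_of_pos (show 0 < n + 1 by linarith)
    simp only [rho]; positivity

theorem rho_zero (kind : RegulationType) (m : ℕ) : rho kind m 0 = 1 := by
  cases kind <;> simp [rho]

end Kernel

/-! ### Step functions, Riemann sums and increment sums -/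

theorem natCeil_mul_eq_succ {u : ℝ} {N j : ℕ}
    (h1 : (j : ℝ) / (N + 1) < u) (h2 : u ≤ ((j + 1 : ℕ) : ℝ) / (N + 1)) :
    ⌈u * (N + 1)⌉₊ = j + 1 := by
  have hN : (0 : ℝ) < N + 1 := by positivity
  rw [div_lt_iff₀ hN] at h1
  rw [le_div_iff₀ hN] at h2
  rw [Nat.ceil_eq_iff (by omega)]
  exact ⟨by simpa using h1, h2⟩

/-- Integration against a step function that is constant on the intervals
`(j / (N + 1), (j + 1) / (N + 1)]`. -/
theorem integral_mul_step {w : ℝ → ℝ} (hw : IntervalIntegrable w volume 0 1) (F : ℕ → ℝ) (N : ℕ) :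
    ∫ u in (0 : ℝ)..1, w u * F ⌈u * (N + 1)⌉₊ =
      ∑ j ∈ Finset.range (N + 1),
        F (j + 1) * ∫ u in ((j : ℝ) / (N + 1))..(((j + 1 : ℕ) : ℝ) / (N + 1)), w u := by
  have hN : (0 : ℝ) < N + 1 := by positivity
  have hle : ∀ j : ℕ, (j : ℝ) / (N + 1) ≤ ((j + 1 : ℕ) : ℝ) / (N + 1) := fun j => by
    gcongr; simp
  have hsub : ∀ j < N + 1, IntervalIntegrable w volume ((j : ℝ) / (N + 1))
      (((j + 1 : ℕ) : ℝ) / (N + 1)) := fun j hj => by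
    refine hw.mono_set ?_
    rw [Set.uIcc_of_le (hle j), Set.uIcc_of_le zero_le_one]
    refine Set.Icc_subset_Icc (by positivity) ?_
    rw [div_le_one hN]
    exact_mod_cast hj
  have hcongr : ∀ j : ℕ, ∀ u ∈ Set.uIoc ((j : ℝ) / (N + 1)) (((j + 1 : ℕ) : ℝ) / (N + 1)),
      w u * F (j + 1) = w u * F ⌈u * (N + 1)⌉₊ := by
    intro j u hu
    rw [Set.uIoc_of_le (hle j)] at hu
    rw [natCeil_mul_eq_succ hu.1 hu.2]
  have hint : ∀ j < N + 1, IntervalIntegrable (fun u => w u * F ⌈u * (N + 1)⌉₊) volume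
      ((j : ℝ) / (N + 1)) (((j + 1 : ℕ) : ℝ) / (N + 1)) := fun j hj =>
    ((hsub j hj).mul_const (F (j + 1))).congr (fun u hu => hcongr j u hu)
  have h := intervalIntegral.sum_integral_adjacent_intervals
    (a := fun j : ℕ => (j : ℝ) / (N + 1)) (n := N + 1) hint
  simp only [Nat.cast_zero, zero_div] at h
  rw [show ((N + 1 : ℕ) : ℝ) / (N + 1) = 1 by push_cast; exact div_self hN.ne'] at h
  rw [← h]
  refine Finset.sum_congr rfl fun j _ => ?_
  rw [← intervalIntegral.integral_congr_ae (ae_of_all _ (hcongr j)),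
    intervalIntegral.integral_mul_const, mul_comm]

theorem measurable_natCeil_mul (N : ℕ) : Measurable (fun u : ℝ => ⌈u * ((N : ℝ) + 1)⌉₊) :=
  Nat.measurable_ceil.comp (measurable_id.mul_const _)

theorem sum_mul_sub_eq_sum_sub_mul (F G : ℕ → ℝ) (M : ℕ) :
    ∑ j ∈ Finset.range M, F (j + 1) * (G j - G (j + 1)) =
      ∑ j ∈ Finset.range M, (F (j + 1) - F j) * G j - F M * G M + F 0 * G 0 := by
  induction M with
  | zero => simp
  | succ M ih => rw [Finset.sum_range_succ, ih, Finset.sum_range_succ]; ring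

theorem tendsto_natCeil_mul_div_real {u : ℝ} (hu : 0 ≤ u) :
    Tendsto (fun N : ℕ => (⌈u * (N + 1)⌉₊ : ℝ) / (N + 1)) atTop (𝓝 u) := by
  have := (NNReal.continuous_coe.tendsto _).comp (tendsto_natCeil_mul_div u)
  simpa [Function.comp_def, Real.coe_toNNReal _ hu] using this

/-- Left Riemann sums of a continuous function converge to its integral. -/
theorem tendsto_riemannSum {h : ℝ → ℝ} (hh : ContinuousOn h (Set.Icc 0 1)) :
    Tendsto (fun N : ℕ => (1 / ((N : ℝ) + 1)) * ∑ j ∈ Finset.range (N + 1), h (j / (N + 1)))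
      atTop (𝓝 (∫ s in (0 : ℝ)..1, h s)) := by
  -- On the cell `(j / (N + 1), (j + 1) / (N + 1)]` the ceiling is `j + 1`; subtracting `1` samples
  -- the left endpoint.
  have hstep : ∀ N : ℕ, (1 / ((N : ℝ) + 1)) * ∑ j ∈ Finset.range (N + 1), h (j / (N + 1)) =
      ∫ u in (0 : ℝ)..1, (1 : ℝ) * (fun k : ℕ => h (((k : ℝ) - 1) / (N + 1))) ⌈u * (N + 1)⌉₊ := by
    intro N
    rw [integral_mul_step (w := fun _ => 1) intervalIntegrable_const
      (fun k : ℕ => h (((k : ℝ) - 1) / (N + 1))) N, Finset.mul_sum]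
    refine Finset.sum_congr rfl fun j _ => ?_
    rw [intervalIntegral.integral_const, smul_eq_mul, mul_one]
    push_cast
    rw [add_sub_cancel_right, mul_comm]
    congr 1
    ring
  simp_rw [hstep]
  obtain ⟨B, hB⟩ := isCompact_Icc.exists_bound_of_continuousOn hh
  have hmem : ∀ N : ℕ, ∀ u ∈ Set.Ioc (0 : ℝ) 1,
      ((⌈u * (N + 1)⌉₊ : ℝ) - 1) / (N + 1) ∈ Set.Icc (0 : ℝ) 1 := by
    intro N u hu
    have hN : (0 : ℝ) < N + 1 := by positivity
    have h1 : 1 ≤ ⌈u * (N + 1)⌉₊ := Nat.one_le_ceil_iff.2 (mul_pos hu.1 hN)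
    have h2 : ⌈u * (N + 1)⌉₊ ≤ N + 1 := Nat.ceil_le.2 (by push_cast; nlinarith [hu.2])
    have h1' : (1 : ℝ) ≤ ⌈u * (N + 1)⌉₊ := by exact_mod_cast h1
    have h2' : (⌈u * (N + 1)⌉₊ : ℝ) ≤ N + 1 := by exact_mod_cast h2
    refine ⟨div_nonneg (by linarith) hN.le, ?_⟩
    rw [div_le_one hN]
    linarith
  refine intervalIntegral.tendsto_integral_filter_of_dominated_convergence (fun _ => B) ?_ ?_
    intervalIntegrable_const ?_
  · refine Eventually.of_forall fun N => Measurable.aestronglyMeasurable ?_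
    exact (Measurable.comp (g := fun k : ℕ => h (((k : ℝ) - 1) / (N + 1))) measurable_from_nat
      (measurable_natCeil_mul N)).const_mul 1
  · refine Eventually.of_forall fun N => ae_of_all _ fun u hu => ?_
    rw [Set.uIoc_of_le zero_le_one] at hu
    rw [one_mul]
    exact hB _ (hmem N u hu)
  · refine ae_of_all _ fun u hu => ?_
    rw [Set.uIoc_of_le zero_le_one] at hu
    simp only [one_mul]
    have ht : Tendsto (fun N : ℕ => ((⌈u * (N + 1)⌉₊ : ℝ) - 1) / (N + 1)) atTop (𝓝 u) := by
      have := (tendsto_natCeil_mul_div_real hu.1.le).sub tendsto_one_div_add_atTop_nhds_zero_nat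
      simpa [sub_div] using this
    exact (hh u ⟨hu.1.le, hu.2⟩).tendsto.comp
      (tendsto_nhdsWithin_iff.2 ⟨ht, Eventually.of_forall fun N => hmem N u hu⟩)

section WeightedAverage

variable {w : ℝ → ℝ}

theorem integral_tail_nonneg (hw0 : ∀ u ∈ Set.Ioo (0 : ℝ) 1, 0 ≤ w u)
    {s : ℝ} (hs0 : 0 ≤ s) (hs1 : s ≤ 1) : 0 ≤ ∫ u in s..1, w u := by
  rw [intervalIntegral.integral_of_le hs1, integral_Ioc_eq_integral_Ioo]
  exact setIntegral_nonneg measurableSet_Ioo fun u hu => hw0 u ⟨hs0.trans_lt hu.1, hu.2⟩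

theorem integral_tail_le (hw : IntervalIntegrable w volume 0 1)
    (hw0 : ∀ u ∈ Set.Ioo (0 : ℝ) 1, 0 ≤ w u)
    {s : ℝ} (hs0 : 0 ≤ s) (hs1 : s ≤ 1) : ∫ u in s..1, w u ≤ ∫ u in (0 : ℝ)..1, w u := by
  rw [intervalIntegral.integral_of_le hs1, intervalIntegral.integral_of_le zero_le_one,
    integral_Ioc_eq_integral_Ioo, integral_Ioc_eq_integral_Ioo]
  rw [intervalIntegrable_iff_integrableOn_Ioo_of_le zero_le_one] at hw
  refine setIntegral_mono_set hw ?_ (Set.Ioo_subset_Ioo_left hs0).eventuallyLE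
  exact (ae_restrict_iff' measurableSet_Ioo).2 (ae_of_all _ hw0)

theorem continuousOn_integral_tail (hw : IntervalIntegrable w volume 0 1) :
    ContinuousOn (fun s => ∫ u in s..1, w u) (Set.Icc 0 1) := by
  have := intervalIntegral.continuousOn_primitive_interval_left (μ := volume) (f := w)
    (a := 0) (b := 1) (by
      rwa [Set.uIcc_of_le zero_le_one, integrableOn_Icc_iff_integrableOn_Ioc,
        ← intervalIntegrable_iff_integrableOn_Ioc_of_le zero_le_one])
  rwa [Set.uIcc_of_le zero_le_one] at this

/-- The approximation of `∫ w(u) f(t u) du` by a weighted sum of increments of `f`. -/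
def incrementSum (w : ℝ → ℝ) (f : ℝ≥0 → ℝ) (t : ℝ≥0) (N : ℕ) : ℝ :=
  ∑ j ∈ Finset.range (N + 1),
    (∫ u in ((j : ℝ) / (N + 1))..1, w u) *
      (f (t * ((j + 1 : ℕ) / (N + 1))) - f (t * (j / (N + 1))))

/-- Abel summation. The boundary term at `1` vanishes because the tail integral there is empty, the
one at `0` because `f 0 = 0`. -/
theorem incrementSum_eq_integral (hw : IntervalIntegrable w volume 0 1) {f : ℝ≥0 → ℝ}
    (hf0 : f 0 = 0) (t : ℝ≥0) (N : ℕ) :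
    incrementSum w f t N =
      ∫ u in (0 : ℝ)..1, w u * f (t * ((⌈u * (N + 1)⌉₊ : ℝ≥0) / (N + 1))) := by
  have hN : (0 : ℝ) < N + 1 := by positivity
  rw [integral_mul_step hw (fun k => f (t * ((k : ℝ≥0) / (N + 1)))) N]
  have hG : ∀ j ∈ Finset.range (N + 1),
      (fun k : ℕ => f (t * ((k : ℝ≥0) / (N + 1)))) (j + 1) *
        (∫ u in ((j : ℝ) / (N + 1))..(((j + 1 : ℕ) : ℝ) / (N + 1)), w u) =
      (fun k : ℕ => f (t * ((k : ℝ≥0) / (N + 1)))) (j + 1) *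
        ((fun k : ℕ => ∫ u in ((k : ℝ) / (N + 1))..1, w u) j -
          (fun k : ℕ => ∫ u in ((k : ℝ) / (N + 1))..1, w u) (j + 1)) := by
    intro j hj
    have hj' : j + 1 ≤ N + 1 := Finset.mem_range.1 hj
    have hmem : ∀ k : ℕ, k ≤ N + 1 → IntervalIntegrable w volume ((k : ℝ) / (N + 1)) 1 := by
      intro k hk
      have hk1 : (k : ℝ) / (N + 1) ≤ 1 := by rw [div_le_one hN]; exact_mod_cast hk
      refine hw.mono_set ?_
      rw [Set.uIcc_of_le hk1, Set.uIcc_of_le zero_le_one]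
      exact Set.Icc_subset_Icc_left (by positivity)
    congr 1
    exact eq_sub_of_add_eq (intervalIntegral.integral_add_adjacent_intervals
      ((hmem j (by omega)).trans (hmem (j + 1) hj').symm) (hmem (j + 1) hj'))
  rw [Finset.sum_congr rfl hG,
    sum_mul_sub_eq_sum_sub_mul (fun k : ℕ => f (t * ((k : ℝ≥0) / (N + 1))))
      (fun k : ℕ => ∫ u in ((k : ℝ) / (N + 1))..1, w u)]
  have h1 : ((N + 1 : ℕ) : ℝ) / (N + 1) = 1 := by push_cast; exact div_self hN.ne'
  simp only [h1, intervalIntegral.integral_same, mul_zero, sub_zero, Nat.cast_zero, zero_div, hf0,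
    zero_mul, add_zero]
  exact Finset.sum_congr rfl fun j _ => mul_comm _ _

/-- The grid points approach `t u` from the right, so right-continuity suffices; monotonicity bounds
the integrand by `|w u| * f t`. -/
theorem tendsto_incrementSum (hw : IntervalIntegrable w volume 0 1)
    {f : ℝ≥0 → ℝ} (hf0 : f 0 = 0) (hf : Monotone f)
    (hfc : ∀ t, ContinuousWithinAt f (Set.Ici t) t) (t : ℝ≥0) :
    Tendsto (incrementSum w f t) atTop
      (𝓝 (∫ u in (0 : ℝ)..1, w u * f (t * u.toNNReal))) := by
  have hfun : incrementSum w f t = fun N : ℕ =>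
      ∫ u in (0 : ℝ)..1, w u * f (t * ((⌈u * (N + 1)⌉₊ : ℝ≥0) / (N + 1))) :=
    funext fun N => incrementSum_eq_integral hw hf0 t N
  have hfpos : ∀ s, 0 ≤ f s := fun s => hf0 ▸ hf zero_le
  rw [hfun]
  refine intervalIntegral.tendsto_integral_filter_of_dominated_convergence
    (fun u => |w u| * f t) ?_ ?_ (hw.abs.mul_const _) ?_
  · refine Eventually.of_forall fun N => ?_
    rw [Set.uIoc_of_le zero_le_one]
    refine ((intervalIntegrable_iff_integrableOn_Ioc_of_le
      zero_le_one).1 hw).aestronglyMeasurable.mul (Measurable.aestronglyMeasurable ?_)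
    exact Measurable.comp (g := fun k : ℕ => f (t * ((k : ℝ≥0) / (N + 1)))) measurable_from_nat
      (measurable_natCeil_mul N)
  · refine Eventually.of_forall fun N => ae_of_all _ fun u hu => ?_
    rw [Set.uIoc_of_le zero_le_one] at hu
    rw [norm_mul, Real.norm_eq_abs, Real.norm_eq_abs, abs_of_nonneg (hfpos _)]
    refine mul_le_mul_of_nonneg_left (hf ?_) (abs_nonneg _)
    refine mul_le_of_le_one_right' ?_
    have hN : (0 : ℝ≥0) < N + 1 := by positivity
    rw [div_le_one hN]
    have : ⌈u * ((N : ℝ) + 1)⌉₊ ≤ N + 1 := by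
      refine Nat.ceil_le.2 ?_
      push_cast
      exact mul_le_of_le_one_left (by positivity) hu.2
    exact_mod_cast this
  · refine ae_of_all _ fun u hu => ?_
    rw [Set.uIoc_of_le zero_le_one] at hu
    refine Tendsto.const_mul _ ?_
    refine (hfc (t * u.toNNReal)).tendsto.comp (tendsto_nhdsWithin_iff.2
      ⟨(tendsto_natCeil_mul_div u).const_mul t, Eventually.of_forall fun N => ?_⟩)
    refine Set.mem_Ici.2 (mul_le_mul_right ?_ t)
    have hN : (0 : ℝ≥0) < N + 1 := by positivity
    rw [le_div_iff₀ hN, ← NNReal.coe_le_coe]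
    push_cast
    rw [Real.coe_toNNReal _ hu.1.le]
    exact Nat.le_ceil _

/-- Increments are nonnegative and each tail is at most the full integral, so the sum telescopes.
The bound is uniform in `N`, as dominated convergence of the exponentials requires. -/
theorem abs_incrementSum_le (hw : IntervalIntegrable w volume 0 1)
    (hw0 : ∀ u ∈ Set.Ioo (0 : ℝ) 1, 0 ≤ w u) {f : ℝ≥0 → ℝ} (hf0 : f 0 = 0) (hf : Monotone f)
    (t : ℝ≥0) (N : ℕ) :
    |incrementSum w f t N| ≤ (∫ u in (0 : ℝ)..1, w u) * f t := by
  have hN : (0 : ℝ) < N + 1 := by positivity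
  have htele : (∫ u in (0 : ℝ)..1, w u) * f t = ∑ j ∈ Finset.range (N + 1),
      (∫ u in (0 : ℝ)..1, w u) *
        (f (t * ((j + 1 : ℕ) / (N + 1))) - f (t * (j / (N + 1)))) := by
    rw [← Finset.mul_sum, Finset.sum_range_sub (fun j : ℕ => f (t * ((j : ℝ≥0) / (N + 1))))]
    have h1 : ((N + 1 : ℕ) : ℝ≥0) / (N + 1) = 1 := by
      push_cast; exact div_self (by positivity)
    rw [h1]
    simp [hf0]
  have hinc : ∀ j : ℕ, 0 ≤ f (t * ((j + 1 : ℕ) / (N + 1))) - f (t * (j / (N + 1))) := by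
    intro j
    refine sub_nonneg.2 (hf (mul_le_mul_right ?_ t))
    gcongr
    simp
  have hle : ∀ j ∈ Finset.range (N + 1), (j : ℝ) / (N + 1) ≤ 1 := fun j hj => by
    rw [div_le_one hN]
    exact_mod_cast (Finset.mem_range.1 hj).le
  rw [abs_of_nonneg, htele]
  · exact Finset.sum_le_sum fun j hj => mul_le_mul_of_nonneg_right
      (integral_tail_le hw hw0 (by positivity) (hle j hj)) (hinc j)
  · exact Finset.sum_nonneg fun j hj =>
      mul_nonneg (integral_tail_nonneg hw0 (by positivity) (hle j hj)) (hinc j)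

end WeightedAverage

/-! ### Generating functions of weighted path integrals -/

section Subordinator

variable {Ω : Type*} [MeasurableSpace Ω] {P : Measure Ω} {X : ℝ≥0 → Ω → ℝ} {w : ℝ → ℝ}
  {r : ℝ} {ψ : ℝ → ℝ}

theorem IsSubordinator.mgf_increment (hX : IsSubordinator X P) (s t : ℝ≥0) (z : ℝ) :
    mgf (fun ω => X (s + t) ω - X s ω) P z = mgf (X t) P z :=
  congrFun (mgf_congr_identDistrib (hX.stationary s t)) z

/-- Independence factorizes the generating function and stationarity gives each factor time `t / (N
+ 1)`, so the exponent is `t` times a left Riemann sum. -/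
theorem IsSubordinator.mgf_incrementSum (hX : IsSubordinator X P)
    (hw : IntervalIntegrable w volume 0 1) (hw0 : ∀ u ∈ Set.Ioo (0 : ℝ) 1, 0 ≤ w u)
    (hmgf : ∀ t : ℝ≥0, ∀ z, |z| < r → mgf (X t) P z = Real.exp (t * ψ z)) {z : ℝ}
    (hz : |z| * (∫ u in (0 : ℝ)..1, w u) < r) (t : ℝ≥0) (N : ℕ) :
    mgf (fun ω => incrementSum w (fun s => X s ω) t N) P z =
      Real.exp (t * ((1 / ((N : ℝ) + 1)) *
        ∑ j ∈ Finset.range (N + 1), ψ (z * ∫ u in ((j : ℝ) / (N + 1))..1, w u))) := by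
  have hN : (0 : ℝ) < N + 1 := by positivity
  have hmono : Monotone (fun j : ℕ => t * ((j : ℝ≥0) / (N + 1))) := fun i j hij =>
    mul_le_mul_right (by gcongr) t
  have hind := (hX.indep.nat hmono).comp
    (fun j x => (∫ u in ((j : ℝ) / (N + 1))..1, w u) * x) (fun j => measurable_const_mul _)
  have hmeas : ∀ j : ℕ, Measurable ((fun x => (∫ u in ((j : ℝ) / (N + 1))..1, w u) * x) ∘
      fun ω => X (t * (((j + 1 : ℕ) : ℝ≥0) / (N + 1))) ω - X (t * ((j : ℝ≥0) / (N + 1))) ω) :=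
    fun j => (measurable_const_mul _).comp ((hX.measurable _).sub (hX.measurable _))
  have hsum := hind.mgf_sum (t := z) hmeas (Finset.range (N + 1))
  have hfun : (∑ j ∈ Finset.range (N + 1), ((fun x => (∫ u in ((j : ℝ) / (N + 1))..1, w u) * x) ∘
      fun ω => X (t * (((j + 1 : ℕ) : ℝ≥0) / (N + 1))) ω - X (t * ((j : ℝ≥0) / (N + 1))) ω)) =
      fun ω => incrementSum w (fun s => X s ω) t N := by
    funext ω
    simp [incrementSum, Finset.sum_apply]
  rw [hfun] at hsum
  rw [hsum, Finset.mul_sum, Finset.mul_sum, Real.exp_sum]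
  refine Finset.prod_congr rfl fun j hj => ?_
  have hj1 : (j : ℝ) / (N + 1) ≤ 1 := by
    rw [div_le_one hN]
    exact_mod_cast (Finset.mem_range.1 hj).le
  have hlt : |z * ∫ u in ((j : ℝ) / (N + 1))..1, w u| < r := by
    rw [abs_mul, abs_of_nonneg (integral_tail_nonneg hw0 (by positivity) hj1)]
    exact (mul_le_mul_of_nonneg_left (integral_tail_le hw hw0 (by positivity) hj1)
      (abs_nonneg z)).trans_lt hz
  have htime : t * (((j + 1 : ℕ) : ℝ≥0) / (N + 1)) =
      t * ((j : ℝ≥0) / (N + 1)) + t * (1 / (N + 1)) := by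
    push_cast; ring
  have h1 := hX.mgf_increment (t * ((j : ℝ≥0) / (N + 1))) (t * (1 / (N + 1)))
    (z * ∫ u in ((j : ℝ) / (N + 1))..1, w u)
  rw [hmgf _ _ hlt, ← htime] at h1
  push_cast at h1
  rw [← mul_assoc, ← h1, mgf, mgf]
  refine integral_congr_ae (ae_of_all _ fun ω => ?_)
  simp only [Function.comp_apply]
  push_cast
  congr 1; ring

/-- The moment generating function of `∫₀¹ w(u) X_{tu} du` for a subordinator `X`. -/
theorem IsSubordinator.mgf_integral_mul (hX : IsSubordinator X P)
    (hψ : ContinuousOn ψ (Set.Ioo (-r) r))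
    (hmgf : ∀ t : ℝ≥0, ∀ z, |z| < r → mgf (X t) P z = Real.exp (t * ψ z))
    (hw : IntervalIntegrable w volume 0 1) (hw0 : ∀ u ∈ Set.Ioo (0 : ℝ) 1, 0 ≤ w u) {z : ℝ}
    (hz : |z| * (∫ u in (0 : ℝ)..1, w u) < r) (t : ℝ≥0) :
    mgf (fun ω => ∫ u in (0 : ℝ)..1, w u * X (t * u.toNNReal) ω) P z =
      Real.exp (t * ∫ s in (0 : ℝ)..1, ψ (z * ∫ u in s..1, w u)) := by
  set C := ∫ u in (0 : ℝ)..1, w u with hC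
  have hC0 : 0 ≤ C := integral_tail_nonneg hw0 le_rfl zero_le_one
  have hcont : ContinuousOn (fun s => ψ (z * ∫ u in s..1, w u)) (Set.Icc 0 1) := by
    refine hψ.comp ((continuousOn_integral_tail hw).const_mul z) fun s hs => ?_
    refine abs_lt.1 ?_
    rw [abs_mul, abs_of_nonneg (integral_tail_nonneg hw0 hs.1 hs.2)]
    exact (mul_le_mul_of_nonneg_left (integral_tail_le hw hw0 hs.1 hs.2)
      (abs_nonneg z)).trans_lt hz
  have hlim1 : Tendsto (fun N : ℕ => mgf (fun ω => incrementSum w (fun s => X s ω) t N) P z) atTop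
      (𝓝 (Real.exp (t * ∫ s in (0 : ℝ)..1, ψ (z * ∫ u in s..1, w u)))) := by
    simp_rw [hX.mgf_incrementSum hw hw0 hmgf hz]
    exact (Real.continuous_exp.tendsto _).comp ((tendsto_riemannSum hcont).const_mul (t : ℝ))
  have hint : Integrable (fun ω => Real.exp (|z| * C * X t ω)) P := by
    refine integrable_exp_mul_of_mgf_ne_zero ?_
    rw [hmgf t _ (by rwa [abs_of_nonneg (by positivity)])]
    exact (Real.exp_pos _).ne'
  have hlim2 : Tendsto (fun N : ℕ => mgf (fun ω => incrementSum w (fun s => X s ω) t N) P z) atTop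
      (𝓝 (mgf (fun ω => ∫ u in (0 : ℝ)..1, w u * X (t * u.toNNReal) ω) P z)) := by
    refine tendsto_integral_of_dominated_convergence _ (fun N => ?_) hint (fun N => ?_) ?_
    · refine Measurable.aestronglyMeasurable ?_
      refine Real.measurable_exp.comp (Measurable.const_mul ?_ z)
      exact Finset.measurable_sum _ fun j _ =>
        ((hX.measurable _).sub (hX.measurable _)).const_mul _
    · filter_upwards [hX.paths] with ω hω
      rw [Real.norm_eq_abs, Real.abs_exp, Real.exp_le_exp]
      refine (le_abs_self _).trans ?_
      rw [abs_mul, mul_assoc]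
      exact mul_le_mul_of_nonneg_left (abs_incrementSum_le hw hw0 hω.1 hω.2.1 t N) (abs_nonneg z)
    · filter_upwards [hX.paths] with ω hω
      exact (Real.continuous_exp.tendsto _).comp
        ((tendsto_incrementSum hw hω.1 hω.2.1 hω.2.2 t).const_mul z)
  exact tendsto_nhds_unique hlim2 hlim1

end Subordinator

/-! ### Fubini for dilations and the weights of iterated averages -/

section DilationFubini

variable {a w φ : ℝ → ℝ}

/-- The substitution `p = u v`; the indicator keeps the domain fixed so that Fubini applies on the
unit square. -/
theorem integral_indicator_comp_div (w φ : ℝ → ℝ) {u : ℝ} (hu0 : 0 < u) (hu1 : u < 1) :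
    ∫ p in Set.Ioo (0 : ℝ) 1, (Set.Iio u).indicator (fun p => u⁻¹ * w (p / u) * φ p) p =
      ∫ v in (0 : ℝ)..1, w v * φ (u * v) := by
  rw [setIntegral_indicator measurableSet_Iio]
  have hset : Set.Ioo (0 : ℝ) 1 ∩ Set.Iio u = Set.Ioo 0 u := by
    ext p
    simp only [Set.mem_inter_iff, Set.mem_Ioo, Set.mem_Iio]
    constructor
    · rintro ⟨⟨h1, -⟩, h2⟩; exact ⟨h1, h2⟩
    · rintro ⟨h1, h2⟩; exact ⟨⟨h1, h2.trans hu1⟩, h2⟩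
  rw [hset, ← integral_Ioc_eq_integral_Ioo, ← intervalIntegral.integral_of_le hu0.le]
  have h := intervalIntegral.integral_comp_mul_left (a := 0) (b := 1)
    (fun p => w (p / u) * φ p) hu0.ne'
  simp only [mul_zero, mul_one, smul_eq_mul, mul_div_cancel_left₀ _ hu0.ne'] at h
  rw [h, ← intervalIntegral.integral_const_mul]
  simp only [mul_assoc]

theorem integrableOn_indicator_comp_div (hw : IntervalIntegrable w volume 0 1)
    (hφ : Measurable φ) {B : ℝ} (hB : ∀ p ∈ Set.Ioo (0 : ℝ) 1, |φ p| ≤ B)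
    {u : ℝ} (hu0 : 0 < u) (hu1 : u < 1) :
    IntegrableOn ((Set.Iio u).indicator (fun p => u⁻¹ * w (p / u) * φ p)) (Set.Ioo 0 1) := by
  have h1 : IntervalIntegrable (fun p => w (u⁻¹ * p)) volume 0 u := by
    have := hw.comp_mul_left (c := u⁻¹)
    simpa using this
  rw [intervalIntegrable_iff_integrableOn_Ioo_of_le hu0.le] at h1
  have h2 : IntegrableOn (fun p => u⁻¹ * w (p / u) * φ p) (Set.Ioo 0 u) := by
    have h3 : IntegrableOn (fun p => u⁻¹ * w (p / u)) (Set.Ioo 0 u) := by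
      refine IntegrableOn.congr_fun (h1.const_mul u⁻¹) (fun p _ => ?_) measurableSet_Ioo
      simp only [div_eq_inv_mul]
    refine Integrable.mul_bdd (c := B) h3 hφ.aestronglyMeasurable ?_
    exact (ae_restrict_iff' measurableSet_Ioo).2
      (ae_of_all _ fun p hp => hB p ⟨hp.1, hp.2.trans hu1⟩)
  rw [IntegrableOn, integrable_indicator_iff measurableSet_Iio, IntegrableOn,
    Measure.restrict_restrict measurableSet_Iio]
  refine h2.mono_set ?_
  rintro p ⟨h3, h4⟩
  exact ⟨h4.1, h3⟩

/-- Fubini's theorem for iterated dilations. -/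
theorem integral_mul_integral_dilation (ha : Measurable a) (hw : Measurable w) (hφ : Measurable φ)
    (hai : IntervalIntegrable a volume 0 1) (hwi : IntervalIntegrable w volume 0 1) {B : ℝ}
    (hB : ∀ p ∈ Set.Ioo (0 : ℝ) 1, |φ p| ≤ B) :
    ∫ u in (0 : ℝ)..1, a u * ∫ v in (0 : ℝ)..1, w v * φ (u * v) =
      ∫ p in (0 : ℝ)..1, (∫ u in p..1, a u * (u⁻¹ * w (p / u))) * φ p := by
  set H : ℝ → ℝ → ℝ := fun u p =>
    a u * (Set.Iio u).indicator (fun p => u⁻¹ * w (p / u) * φ p) p with hH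
  have hHm : Measurable (Function.uncurry H) := by
    have hset : MeasurableSet {q : ℝ × ℝ | q.2 < q.1} :=
      measurableSet_lt measurable_snd measurable_fst
    have h1 : Function.uncurry H = fun q : ℝ × ℝ => a q.1 *
        {q : ℝ × ℝ | q.2 < q.1}.indicator (fun q => q.1⁻¹ * w (q.2 / q.1) * φ q.2) q := by
      funext q
      rfl
    rw [h1]
    refine (ha.comp measurable_fst).mul (Measurable.indicator ?_ hset)
    exact (measurable_fst.inv.mul (hw.comp (measurable_snd.div measurable_fst))).mul
      (hφ.comp measurable_snd)
  have hHi : Integrable (Function.uncurry H)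
      ((volume.restrict (Set.Ioo (0 : ℝ) 1)).prod (volume.restrict (Set.Ioo (0 : ℝ) 1))) := by
    rw [integrable_prod_iff hHm.aestronglyMeasurable]
    constructor
    · refine (ae_restrict_iff' measurableSet_Ioo).2 (ae_of_all _ fun u hu => ?_)
      exact (integrableOn_indicator_comp_div hwi hφ hB hu.1 hu.2).const_mul (a u)
    · rw [intervalIntegrable_iff_integrableOn_Ioo_of_le zero_le_one] at hai
      refine Integrable.mono' (hai.norm.mul_const ((∫ v in (0 : ℝ)..1, |w v|) * B))
        hHm.norm.aestronglyMeasurable.integral_prod_right' ?_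
      refine (ae_restrict_iff' measurableSet_Ioo).2 (ae_of_all _ fun u hu => ?_)
      have h1 : ∫ p in Set.Ioo (0 : ℝ) 1, ‖H u p‖ =
          |a u| * ∫ v in (0 : ℝ)..1, |w v| * |φ (u * v)| := by
        rw [← integral_indicator_comp_div (fun v => |w v|) (fun p => |φ p|) hu.1 hu.2,
          ← integral_const_mul]
        congr 1
        funext p
        simp only [hH, norm_mul, Real.norm_eq_abs, Set.indicator_apply]
        split_ifs
        · rw [abs_mul, abs_mul, abs_of_pos (inv_pos.2 hu.1)]
        · simp
      have h2 : ∫ v in (0 : ℝ)..1, |w v| * |φ (u * v)| ≤ (∫ v in (0 : ℝ)..1, |w v|) * B := by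
        rw [← intervalIntegral.integral_mul_const]
        rw [intervalIntegral.integral_of_le zero_le_one, intervalIntegral.integral_of_le
          zero_le_one, integral_Ioc_eq_integral_Ioo, integral_Ioc_eq_integral_Ioo]
        rw [intervalIntegrable_iff_integrableOn_Ioo_of_le zero_le_one] at hwi
        refine integral_mono_of_nonneg (ae_of_all _ fun v => by positivity)
          (hwi.abs.mul_const B) ?_
        refine (ae_restrict_iff' measurableSet_Ioo).2 (ae_of_all _ fun v hv => ?_)
        refine mul_le_mul_of_nonneg_left (hB _ ⟨mul_pos hu.1 hv.1, ?_⟩) (abs_nonneg _)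
        exact mul_lt_one_of_nonneg_of_lt_one_left hu.1.le hu.2 hv.2.le
      have h3 : ∫ p in Set.Ioo (0 : ℝ) 1, ‖Function.uncurry H (u, p)‖ =
          |a u| * ∫ v in (0 : ℝ)..1, |w v| * |φ (u * v)| := h1
      have h4 : 0 ≤ ∫ v in (0 : ℝ)..1, |w v| * |φ (u * v)| :=
        intervalIntegral.integral_nonneg zero_le_one fun v _ => by positivity
      rw [h3, Real.norm_eq_abs, abs_of_nonneg (by positivity)]
      exact mul_le_mul_of_nonneg_left h2 (abs_nonneg _)
  have hswap := integral_integral_swap hHi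
  rw [intervalIntegral.integral_of_le zero_le_one, intervalIntegral.integral_of_le zero_le_one,
    integral_Ioc_eq_integral_Ioo, integral_Ioc_eq_integral_Ioo]
  calc ∫ u in Set.Ioo (0 : ℝ) 1, a u * ∫ v in (0 : ℝ)..1, w v * φ (u * v)
      = ∫ u in Set.Ioo (0 : ℝ) 1, ∫ p in Set.Ioo (0 : ℝ) 1, H u p := by
        refine setIntegral_congr_fun measurableSet_Ioo fun u hu => ?_
        simp only [hH]
        rw [integral_const_mul, integral_indicator_comp_div w φ hu.1 hu.2]
    _ = ∫ p in Set.Ioo (0 : ℝ) 1, ∫ u in Set.Ioo (0 : ℝ) 1, H u p := hswap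
    _ = ∫ p in Set.Ioo (0 : ℝ) 1, (∫ u in p..1, a u * (u⁻¹ * w (p / u))) * φ p := by
        refine setIntegral_congr_fun measurableSet_Ioo fun p hp => ?_
        have h1 : ∀ u, H u p =
            (Set.Ioi p).indicator (fun u => a u * (u⁻¹ * w (p / u)) * φ p) u := by
          intro u
          simp only [hH, Set.indicator_apply, Set.mem_Iio, Set.mem_Ioi]
          split_ifs <;> ring
        simp only [h1]
        rw [setIntegral_indicator measurableSet_Ioi]
        have hset : Set.Ioo (0 : ℝ) 1 ∩ Set.Ioi p = Set.Ioo p 1 := by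
          ext u
          simp only [Set.mem_inter_iff, Set.mem_Ioo, Set.mem_Ioi]
          constructor
          · rintro ⟨⟨-, h1⟩, h2⟩; exact ⟨h2, h1⟩
          · rintro ⟨h1, h2⟩; exact ⟨⟨hp.1.trans h1, h2⟩, h1⟩
        rw [hset, integral_mul_const, ← integral_Ioc_eq_integral_Ioo,
          ← intervalIntegral.integral_of_le hp.2.le]

end DilationFubini

section IteratedWeights

/-- The weight of the `(k + 1)`-fold running average. -/
def averageWeight (k : ℕ) (u : ℝ) : ℝ := (-Real.log u) ^ k / k.factorial

/-- The weight of the `(k + 1)`-fold iterated integral. -/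
def integralWeight (k : ℕ) (u : ℝ) : ℝ := (1 - u) ^ k / k.factorial

theorem measurable_averageWeight (k : ℕ) : Measurable (averageWeight k) :=
  ((Real.measurable_log.neg).pow_const k).div_const _

theorem continuous_integralWeight (k : ℕ) : Continuous (integralWeight k) := by
  unfold integralWeight; fun_prop

theorem intervalIntegrable_averageWeight (k : ℕ) :
    IntervalIntegrable (averageWeight k) volume 0 1 := by
  rw [intervalIntegrable_iff_integrableOn_Ioo_of_le zero_le_one]
  have h := integrableOn_neg_log_rpow (n := k + 1) (by positivity)
  simp only [add_sub_cancel_right, Real.rpow_natCast] at h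
  exact h.div_const _

theorem averageWeight_nonneg (k : ℕ) {u : ℝ} (hu : u ∈ Set.Ioo (0 : ℝ) 1) :
    0 ≤ averageWeight k u := by
  have := Real.log_neg hu.1 hu.2
  exact div_nonneg (pow_nonneg (by linarith) _) (Nat.cast_nonneg _)

theorem integralWeight_nonneg (k : ℕ) {u : ℝ} (hu : u ∈ Set.Ioo (0 : ℝ) 1) :
    0 ≤ integralWeight k u :=
  div_nonneg (pow_nonneg (by linarith [hu.2]) _) (Nat.cast_nonneg _)

theorem integral_averageWeight (k : ℕ) {s : ℝ} (hs0 : 0 < s) (hs1 : s ≤ 1) :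
    ∫ u in s..1, averageWeight k u = kernelI (k + 1) s := by
  rw [kernelI_eq_integral_log (by positivity) hs0 hs1, Real.Gamma_nat_eq_factorial]
  simp only [averageWeight, add_sub_cancel_right, Real.rpow_natCast,
    intervalIntegral.integral_div]

theorem integral_integralWeight (k : ℕ) (s : ℝ) :
    ∫ u in s..1, integralWeight k u = (1 - s) ^ (k + 1) / (k + 1).factorial := by
  have hd : ∀ u ∈ Set.uIcc s 1, HasDerivAt
      (fun u : ℝ => -((1 - u) ^ (k + 1) / (k + 1).factorial)) (integralWeight k u) u := by
    intro u _
    have := (((hasDerivAt_id u).const_sub 1).pow (k + 1)).div_const ((k + 1).factorial : ℝ) |>.neg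
    refine this.congr_deriv ?_
    rw [integralWeight, Nat.factorial_succ]
    push_cast
    simp only [id]
    field_simp
  rw [intervalIntegral.integral_eq_sub_of_hasDerivAt hd
    ((continuous_integralWeight k).intervalIntegrable _ _)]
  simp

/-- The recursion by which one further running average raises the power of `-log` by one. -/
theorem integral_averageWeight_comp_div (k : ℕ) {p : ℝ} (hp0 : 0 < p) (hp1 : p < 1) :
    ∫ u in p..1, (1 : ℝ) * (u⁻¹ * averageWeight k (p / u)) = averageWeight (k + 1) p := by
  have hpos : ∀ u ∈ Set.uIcc p 1, 0 < u := fun u hu => by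
    rw [Set.uIcc_of_le hp1.le] at hu
    exact hp0.trans_le hu.1
  have hd : ∀ u ∈ Set.uIcc p 1, HasDerivAt
      (fun u : ℝ => (Real.log u - Real.log p) ^ (k + 1) / (k + 1).factorial)
      (1 * (u⁻¹ * averageWeight k (p / u))) u := by
    intro u hu
    have := (((Real.hasDerivAt_log (hpos u hu).ne').sub_const (Real.log p)).pow
      (k + 1)).div_const ((k + 1).factorial : ℝ)
    refine this.congr_deriv ?_
    rw [averageWeight, Real.log_div hp0.ne' (hpos u hu).ne', Nat.factorial_succ]
    push_cast
    simp only [neg_sub]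
    field_simp
  have hcont : ContinuousOn (fun u => (1 : ℝ) * (u⁻¹ * averageWeight k (p / u)))
      (Set.uIcc p 1) := by
    unfold averageWeight
    have h1 : ContinuousOn (fun u : ℝ => p / u) (Set.uIcc p 1) :=
      continuousOn_const.div continuousOn_id fun u hu => (hpos u hu).ne'
    refine continuousOn_const.mul ((continuousOn_id.inv₀ fun u hu => (hpos u hu).ne').mul ?_)
    exact ((h1.log fun u hu => (div_pos hp0 (hpos u hu)).ne').neg.pow k).div_const _
  rw [intervalIntegral.integral_eq_sub_of_hasDerivAt hd hcont.intervalIntegrable]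
  simp [averageWeight]

/-- The recursion for one further integration. The factor `u ^ (k + 1)` comes from `(t u) ^ (k +
1)`, which the inner iterated integral carries at time `t u`. -/
theorem integral_integralWeight_comp_div (k : ℕ) {p : ℝ} (hp0 : 0 < p) (hp1 : p < 1) :
    ∫ u in p..1, u ^ (k + 1) * (u⁻¹ * integralWeight k (p / u)) = integralWeight (k + 1) p := by
  have hd : ∀ u ∈ Set.uIcc p 1, HasDerivAt
      (fun u : ℝ => (u - p) ^ (k + 1) / (k + 1).factorial) ((u - p) ^ k / k.factorial) u := by
    intro u _
    have := (((hasDerivAt_id u).sub_const p).pow (k + 1)).div_const ((k + 1).factorial : ℝ)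
    refine this.congr_deriv ?_
    rw [Nat.factorial_succ]
    push_cast
    simp only [id]
    field_simp
  have hcongr : ∀ u ∈ Set.uIcc p 1,
      u ^ (k + 1) * (u⁻¹ * integralWeight k (p / u)) = (u - p) ^ k / k.factorial := by
    intro u hu
    rw [Set.uIcc_of_le hp1.le] at hu
    have hu0 : u ≠ 0 := (hp0.trans_le hu.1).ne'
    have : u - p = u * (1 - p / u) := by field_simp
    rw [integralWeight, this, mul_pow, pow_succ]
    field_simp
  rw [intervalIntegral.integral_congr hcongr,
    intervalIntegral.integral_eq_sub_of_hasDerivAt hd]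
  · simp [integralWeight]
  · exact Continuous.intervalIntegrable (by fun_prop) _ _

end IteratedWeights

section IteratedAverages

variable {Ω : Type*} {X : ℝ≥0 → Ω → ℝ}

theorem pathIntegral_eq (Y : ℝ≥0 → Ω → ℝ) (t : ℝ≥0) (ω : Ω) :
    pathIntegral Y t ω = t * ∫ u in (0 : ℝ)..1, Y (t * u.toNNReal) ω := by
  rcases eq_or_ne t 0 with rfl | ht
  · simp [pathIntegral]
  have ht' : (t : ℝ) ≠ 0 := by exact_mod_cast ht
  have h := intervalIntegral.integral_comp_mul_left (a := 0) (b := 1)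
    (fun s => Y s.toNNReal ω) ht'
  simp only [mul_zero, mul_one, smul_eq_mul] at h
  rw [pathIntegral]
  have h2 : ∀ u : ℝ, ((t : ℝ) * u).toNNReal = t * u.toNNReal := fun u => by
    rw [Real.toNNReal_mul t.coe_nonneg, Real.toNNReal_coe]
  simp only [h2] at h
  rw [h, ← mul_assoc, mul_inv_cancel₀ ht', one_mul]

/-- The condition `Y 0 ω = 0` is needed at `t = 0`, where the left side is `0` by convention and the
right side is `Y 0 ω`. -/
theorem runningAverage_eq {Y : ℝ≥0 → Ω → ℝ} {ω : Ω} (h0 : Y 0 ω = 0) (t : ℝ≥0) :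
    runningAverage Y t ω = ∫ u in (0 : ℝ)..1, Y (t * u.toNNReal) ω := by
  rw [runningAverage, pathIntegral_eq]
  rcases eq_or_ne t 0 with rfl | ht
  · simp [h0]
  have ht' : (t : ℝ) ≠ 0 := by exact_mod_cast ht
  rw [← mul_assoc, one_div_mul_cancel ht', one_mul]

theorem integral_mul_integral_path {ω : Ω} (h0 : X 0 ω = 0) (hmono : Monotone fun t => X t ω)
    {a w : ℝ → ℝ} (ha : Measurable a) (hw : Measurable w)
    (hai : IntervalIntegrable a volume 0 1) (hwi : IntervalIntegrable w volume 0 1) (t : ℝ≥0) :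
    ∫ u in (0 : ℝ)..1, a u * ∫ v in (0 : ℝ)..1, w v * X (t * u.toNNReal * v.toNNReal) ω =
      ∫ p in (0 : ℝ)..1, (∫ u in p..1, a u * (u⁻¹ * w (p / u))) * X (t * p.toNNReal) ω := by
  have hφ : Measurable (fun p : ℝ => X (t * p.toNNReal) ω) :=
    Monotone.measurable fun p q hpq => hmono (mul_le_mul_right (Real.toNNReal_le_toNNReal hpq) t)
  have hB : ∀ p ∈ Set.Ioo (0 : ℝ) 1, |X (t * p.toNNReal) ω| ≤ X t ω := by
    intro p hp
    have hnn : 0 ≤ X (t * p.toNNReal) ω := by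
      rw [← h0]; exact hmono zero_le
    rw [abs_of_nonneg hnn]
    exact hmono (mul_le_of_le_one_right' (Real.toNNReal_le_one.2 hp.2.le))
  rw [← integral_mul_integral_dilation ha hw hφ hai hwi hB]
  refine intervalIntegral.integral_congr fun u hu => ?_
  rw [Set.uIcc_of_le zero_le_one] at hu
  simp only [Real.toNNReal_mul hu.1, mul_assoc]

theorem runningAverage_iterate_eq {ω : Ω} (h0 : X 0 ω = 0) (hmono : Monotone fun t => X t ω)
    (k : ℕ) (t : ℝ≥0) :
    (runningAverage^[k + 1] X) t ω =
      ∫ u in (0 : ℝ)..1, averageWeight k u * X (t * u.toNNReal) ω := by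
  induction k generalizing t with
  | zero =>
    rw [zero_add, Function.iterate_one, runningAverage_eq h0]
    simp [averageWeight]
  | succ k ih =>
    rw [Function.iterate_succ_apply', runningAverage_eq (by rw [ih]; simp [h0])]
    simp only [ih]
    have h := integral_mul_integral_path h0 hmono (a := fun _ => 1) measurable_const
      (measurable_averageWeight k) intervalIntegrable_const
      (intervalIntegrable_averageWeight k) t
    simp only [one_mul] at h
    rw [h]
    rw [intervalIntegral.integral_of_le zero_le_one, intervalIntegral.integral_of_le zero_le_one,
      integral_Ioc_eq_integral_Ioo, integral_Ioc_eq_integral_Ioo]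
    refine setIntegral_congr_fun measurableSet_Ioo fun p hp => ?_
    have := integral_averageWeight_comp_div k hp.1 hp.2
    simp only [one_mul] at this
    simp only [this]

theorem pathIntegral_iterate_eq {ω : Ω} (h0 : X 0 ω = 0) (hmono : Monotone fun t => X t ω)
    (k : ℕ) (t : ℝ≥0) :
    (pathIntegral^[k + 1] X) t ω =
      t ^ (k + 1) * ∫ u in (0 : ℝ)..1, integralWeight k u * X (t * u.toNNReal) ω := by
  induction k generalizing t with
  | zero =>
    rw [zero_add, Function.iterate_one, pathIntegral_eq]
    simp [integralWeight]
  | succ k ih =>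
    rw [Function.iterate_succ_apply', pathIntegral_eq]
    simp only [ih]
    have h := integral_mul_integral_path h0 hmono (a := fun u => u ^ (k + 1)) (by fun_prop)
      (continuous_integralWeight k).measurable (Continuous.intervalIntegrable (by fun_prop) _ _)
      ((continuous_integralWeight k).intervalIntegrable _ _) t
    have h2 : ∫ u in (0 : ℝ)..1, ((t * u.toNNReal : ℝ≥0) : ℝ) ^ (k + 1) *
        ∫ v in (0 : ℝ)..1, integralWeight k v * X (t * u.toNNReal * v.toNNReal) ω =
        (t : ℝ) ^ (k + 1) * ∫ u in (0 : ℝ)..1, u ^ (k + 1) *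
          ∫ v in (0 : ℝ)..1, integralWeight k v * X (t * u.toNNReal * v.toNNReal) ω := by
      rw [← intervalIntegral.integral_const_mul]
      refine intervalIntegral.integral_congr fun u hu => ?_
      rw [Set.uIcc_of_le zero_le_one] at hu
      simp only [NNReal.coe_mul, Real.coe_toNNReal _ hu.1, mul_pow, mul_assoc]
    rw [h2, h, ← mul_assoc, ← pow_succ']
    congr 1
    rw [intervalIntegral.integral_of_le zero_le_one, intervalIntegral.integral_of_le zero_le_one,
      integral_Ioc_eq_integral_Ioo, integral_Ioc_eq_integral_Ioo]
    refine setIntegral_congr_fun measurableSet_Ioo fun p hp => ?_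
    simp only [integral_integralWeight_comp_div k hp.1 hp.2]

end IteratedAverages

/-! ### Cumulants of regulated clocks -/

section Clocks

variable {Ω : Type*} [MeasurableSpace Ω] {P : Measure Ω}

/-- On `(-r, r)`, the cumulant generating function of `T t` is `t D 0`, and `D` is the sequence of
derivatives of `D 0`. -/
structure HasCumulantTower (P : Measure Ω) (T : ℝ≥0 → Ω → ℝ) (r : ℝ) (D : ℕ → ℝ → ℝ) : Prop where
  isDerivTower : IsDerivTower r D
  mgf_eq : ∀ (t : ℝ≥0) (z : ℝ), |z| < r → mgf (T t) P z = Real.exp (t * D 0 z)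

theorem IsTemperedStableSubordinator.hasCumulantTower {a b c : ℝ} {X : ℝ≥0 → Ω → ℝ}
    (hX : IsTemperedStableSubordinator a b c X P) (hb : 0 < b) (hc0 : 0 ≤ c) (hc1 : c < 1) :
    HasCumulantTower P X b (temperedStableTower a b c) where
  isDerivTower := isDerivTower_temperedStableTower hb hc0 hc1
  mgf_eq t z hz := by
    have := hX.laplace t (-z) (by linarith [(abs_lt.1 hz).2])
    simp only [neg_neg] at this
    exact this

/-- Only one-time laws of `T` are prescribed, so the hypothesis compares generating functions. The
exponent is a mixture of dilations by the tail of `w`, whose moments multiply the derivatives at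
`0`. -/
theorem HasCumulantTower.weightedAverage {X T : ℝ≥0 → Ω → ℝ} {r : ℝ} {D : ℕ → ℝ → ℝ} (hr : 0 < r)
    (h : HasCumulantTower P X r D) (hX : IsSubordinator X P) {w : ℝ → ℝ}
    (hw : IntervalIntegrable w volume 0 1) (hw0 : ∀ u ∈ Set.Ioo (0 : ℝ) 1, 0 ≤ w u)
    (hT : ∀ t z, mgf (T t) P z =
      mgf (fun ω => ∫ u in (0 : ℝ)..1, w u * X (t * u.toNNReal) ω) P z) :
    ∃ r' > 0, ∃ D' : ℕ → ℝ → ℝ, HasCumulantTower P T r' D' ∧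
      ∀ m, D' m 0 = (∫ s in (0 : ℝ)..1, (∫ u in s..1, w u) ^ m) * D m 0 := by
  set C := ∫ u in (0 : ℝ)..1, w u with hC
  have hC0 : 0 ≤ C := integral_tail_nonneg hw0 le_rfl zero_le_one
  -- `C` may vanish for a general weight; `C + 1` is a strictly positive bound on the dilation
  -- factors.
  have hC1 : 0 < C + 1 := by linarith
  set G : ℝ → ℝ := fun s => ∫ u in s..1, w u with hG
  have hGm : AEMeasurable G (volume.restrict (Set.Ioc 0 1)) :=
    ((continuousOn_integral_tail hw).mono Set.Ioc_subset_Icc_self).aemeasurable measurableSet_Ioc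
  have hGC : ∀ᵐ s ∂(volume.restrict (Set.Ioc (0 : ℝ) 1)), |G s| ≤ C + 1 := by
    refine (ae_restrict_iff' measurableSet_Ioc).2 (ae_of_all _ fun s hs => ?_)
    rw [abs_of_nonneg (integral_tail_nonneg hw0 hs.1.le hs.2)]
    linarith [integral_tail_le hw hw0 hs.1.le hs.2]
  refine ⟨r / (C + 1), by positivity,
    fun m z => ∫ s in Set.Ioc 0 1, (1 : ℝ) * G s ^ m * D m (z * G s),
    ⟨h.isDerivTower.integral_dilation hC1 (v := fun _ => 1) (by simp) hGm hGC, ?_⟩, ?_⟩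
  · intro t z hz
    rw [lt_div_iff₀ hC1] at hz
    rw [hT, hX.mgf_integral_mul (h.isDerivTower.continuousOn 0) h.mgf_eq hw hw0
      (by rw [← hC]; nlinarith [abs_nonneg z]) t, intervalIntegral.integral_of_le zero_le_one]
    simp [hG]
  · intro m
    simp only [zero_mul, one_mul]
    rw [integral_mul_const, intervalIntegral.integral_of_le zero_le_one]

theorem integral_kernelI_pow_eq (k m : ℕ) :
    ∫ s in (0 : ℝ)..1, (∫ u in s..1, averageWeight k u) ^ m =
      rho .typeI m ((k + 1 : ℕ) : ℝ) := by
  have hk : ((k + 1 : ℕ) : ℝ) ≠ 0 := by positivity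
  simp only [rho, if_neg hk]
  rw [intervalIntegral.integral_of_le zero_le_one, intervalIntegral.integral_of_le zero_le_one]
  refine setIntegral_congr_fun measurableSet_Ioc fun s hs => ?_
  simp only [integral_averageWeight k hs.1 hs.2]
  push_cast
  rfl

theorem integral_one_sub_pow (j : ℕ) : ∫ s in (0 : ℝ)..1, (1 - s) ^ j = 1 / ((j : ℝ) + 1) := by
  rw [intervalIntegral.integral_comp_sub_left (fun s => s ^ j) 1]
  simp

theorem integral_integralWeight_pow_eq (k m : ℕ) :
    ∫ s in (0 : ℝ)..1, (∫ u in s..1, integralWeight k u) ^ m =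
      rho .typeIII m ((k + 1 : ℕ) : ℝ) := by
  simp only [rho, integral_integralWeight, div_pow, ← pow_mul, Real.Gamma_nat_eq_factorial]
  rw [intervalIntegral.integral_div, integral_one_sub_pow, div_div]
  push_cast
  rw [mul_comm (m : ℝ)]

theorem integral_tail_one_pow (m : ℕ) :
    ∫ s in (0 : ℝ)..1, (∫ _ in s..1, (1 : ℝ)) ^ m = 1 / ((m : ℝ) + 1) := by
  simp [integral_one_sub_pow]

theorem rho_typeII_succ (m k : ℕ) :
    rho .typeII m ((k + 1 : ℕ) : ℝ) = 1 / ((m : ℝ) + 1) * rho .typeII m (k : ℝ) := by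
  simp only [rho, Real.rpow_natCast, pow_succ]
  field_simp

theorem mgf_congr_ae {ξ η : Ω → ℝ} (h : ξ =ᵐ[P] η) (z : ℝ) : mgf ξ P z = mgf η P z :=
  integral_congr_ae (h.mono fun ω hω => by simp only [hω])

/-- Types I and III apply one explicit weight directly to `X`. Type II averages a new subordinator
at each stage, so the claim must also assert that `T` is a subordinator, and each stage contributes
the factor `1 / (m + 1)`. -/
theorem IsAverageInducedClock.exists_hasCumulantTower {X : ℝ≥0 → Ω → ℝ} {r : ℝ}
    {D : ℕ → ℝ → ℝ} (hr : 0 < r) (h : HasCumulantTower P X r D) (hX : IsSubordinator X P)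
    (kind : RegulationType) (k : ℕ) (T : ℝ≥0 → Ω → ℝ)
    (hT : IsAverageInducedClock P X kind k T) :
    IsSubordinator T P ∧ ∃ r' > 0, ∃ D' : ℕ → ℝ → ℝ, HasCumulantTower P T r' D' ∧
      ∀ m, D' m 0 = rho kind m (k : ℝ) * D m 0 := by
  induction k generalizing T with
  | zero =>
    have hTX : T = X := by cases kind <;> simpa [IsAverageInducedClock] using hT
    subst hTX
    exact ⟨hX, r, hr, D, h, fun m => by rw [Nat.cast_zero, rho_zero, one_mul]⟩
  | succ k ih =>
    cases kind with
    | typeI =>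
      obtain ⟨hTs, hTl⟩ := hT
      refine ⟨hTs, ?_⟩
      obtain ⟨r', hr', D', hD', hD0⟩ := h.weightedAverage hr hX (T := T)
        (intervalIntegrable_averageWeight k) (fun u hu => averageWeight_nonneg k hu) (by
          intro t z
          rw [mgf_congr_identDistrib (hTl t)]
          refine mgf_congr_ae ?_ z
          filter_upwards [hX.paths] with ω hω
          exact runningAverage_iterate_eq hω.1 hω.2.1 k t)
      refine ⟨r', hr', D', hD', fun m => ?_⟩
      rw [hD0, integral_kernelI_pow_eq]
    | typeII =>
      obtain ⟨hTs, Y, hY, hTl⟩ := hT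
      obtain ⟨hYs, r₁, hr₁, D₁, hD₁, hD₁0⟩ := ih Y hY
      refine ⟨hTs, ?_⟩
      obtain ⟨r', hr', D', hD', hD0⟩ := hD₁.weightedAverage hr₁ hYs (T := T)
        (w := fun _ => 1) intervalIntegrable_const (fun u hu => zero_le_one) (by
          intro t z
          rw [mgf_congr_identDistrib (hTl t)]
          refine mgf_congr_ae ?_ z
          filter_upwards [hYs.paths] with ω hω
          rw [runningAverage_eq hω.1]
          simp only [one_mul])
      refine ⟨r', hr', D', hD', fun m => ?_⟩
      rw [hD0, hD₁0, integral_tail_one_pow, rho_typeII_succ, mul_assoc]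
    | typeIII =>
      obtain ⟨hTs, hTl⟩ := hT
      refine ⟨hTs, ?_⟩
      obtain ⟨r', hr', D', hD', hD0⟩ := h.weightedAverage hr hX (T := T)
        ((continuous_integralWeight k).intervalIntegrable _ _)
        (fun u hu => integralWeight_nonneg k hu) (by
          intro t z
          rw [mgf_congr_identDistrib (hTl t)]
          refine mgf_congr_ae ?_ z
          filter_upwards [hX.paths] with ω hω
          rw [pathIntegral_iterate_eq hω.1 hω.2.1]
          -- At `t = 0` the factor `t ^ (k + 1)` cannot be cancelled; both sides vanish because `X`
          -- starts at `0`.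
          rcases eq_or_ne t 0 with rfl | ht
          · simp [hω.1]
          · have ht' : (t : ℝ) ≠ 0 := by exact_mod_cast ht
            field_simp)
      refine ⟨r', hr', D', hD', fun m => ?_⟩
      rw [hD0, integral_integralWeight_pow_eq]

section RealDegree

variable {X : ℝ≥0 → Ω → ℝ} {r : ℝ} {D : ℕ → ℝ → ℝ} {n : ℝ}

theorem HasCumulantTower.cgf_one (h : HasCumulantTower P X r D) {z : ℝ} (hz : |z| < r) :
    cgf (X 1) P z = D 0 z := by
  rw [cgf, h.mgf_eq 1 z hz, Real.log_exp, NNReal.coe_one, one_mul]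

/-- Mixtures of dilations of the cumulant generating function of `X 1`. -/
theorem HasCumulantTower.exists_mixture (hr : 0 < r) (h : HasCumulantTower P X r D)
    {C : ℝ} (hC : 0 < C) {v g : ℝ → ℝ} (hv : IntegrableOn v (Set.Ioo 0 1))
    (hg : AEMeasurable g (volume.restrict (Set.Ioo 0 1)))
    (hgC : ∀ᵐ s ∂(volume.restrict (Set.Ioo (0 : ℝ) 1)), |g s| ≤ C) {κ : ℕ → ℝ}
    (hκ : ∀ m, ∫ s in Set.Ioo (0 : ℝ) 1, v s * g s ^ m = κ m) {L : ℝ → ℝ}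
    (hL : ∀ u, L u = ∫ s in Set.Ioo (0 : ℝ) 1, v s * cgf (X 1) P (-(g s * u))) :
    ∃ r' > 0, ∃ D' : ℕ → ℝ → ℝ, IsDerivTower r' D' ∧ (∀ z, |z| < r' → L (-z) = D' 0 z) ∧
      ∀ m, D' m 0 = κ m * D m 0 := by
  refine ⟨r / C, by positivity, fun m z => ∫ s in Set.Ioo 0 1, v s * g s ^ m * D m (z * g s),
    h.isDerivTower.integral_dilation hC hv hg hgC, ?_, ?_⟩
  · intro z hz
    rw [hL]
    refine integral_congr_ae ?_
    filter_upwards [hgC] with s hs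
    have hlt : |z * g s| < r := by
      rw [lt_div_iff₀ hC] at hz
      rw [abs_mul]
      exact (mul_le_mul_of_nonneg_left hs (abs_nonneg z)).trans_lt hz
    rw [mul_neg, neg_neg, mul_comm (g s), h.cgf_one hlt, pow_zero, mul_one]
  · intro m
    simp only [zero_mul]
    rw [integral_mul_const, hκ]

theorem intervalIntegral_zero_one_eq_Ioo (f : ℝ → ℝ) :
    ∫ s in (0 : ℝ)..1, f s = ∫ s in Set.Ioo (0 : ℝ) 1, f s := by
  rw [intervalIntegral.integral_of_le zero_le_one, integral_Ioc_eq_integral_Ioo]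

/-- Each formula is a mixture of dilations: by the kernel under Lebesgue measure (I), by `s` under
the density `(-log s) ^ (n - 1) / Γ(n)` (II), by `s ^ n / Γ(n + 1)` (III). The moments of these
factors are `rho`. -/
theorem exists_derivTower_regulatedLogLT (hr : 0 < r) (h : HasCumulantTower P X r D) (hn : 0 < n)
    (kind : RegulationType) :
    ∃ r' > 0, ∃ D' : ℕ → ℝ → ℝ, IsDerivTower r' D' ∧
      (∀ z, |z| < r' → regulatedLogLT P X kind n (-z) = D' 0 z) ∧
      ∀ m, D' m 0 = rho kind m n * D m 0 := by
  have hG := Real.Gamma_pos_of_pos hn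
  cases kind with
  | typeI =>
    refine h.exists_mixture hr one_pos (v := fun _ => 1) (g := kernelI n) (by simp)
      (aemeasurable_kernelI hn) (abs_kernelI_le_one hn) (fun m => ?_) (fun u => ?_)
    · simp only [rho, if_neg hn.ne', one_mul, intervalIntegral_zero_one_eq_Ioo]
    · simp only [regulatedLogLT, one_mul, intervalIntegral_zero_one_eq_Ioo]
  | typeII =>
    refine h.exists_mixture hr one_pos (v := fun s => 1 / Real.Gamma n * (-Real.log s) ^ (n - 1))
      (g := fun s => s) ((integrableOn_neg_log_rpow hn).const_mul _) aemeasurable_id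
      ?_ (fun m => ?_) (fun u => ?_)
    · refine (ae_restrict_iff' measurableSet_Ioo).2 (ae_of_all _ fun s hs => ?_)
      rw [abs_of_pos hs.1]; exact hs.2.le
    · simp only [rho, mul_assoc]
      rw [integral_const_mul, integral_neg_log_rpow_mul_pow hn]
      field_simp
    · simp only [regulatedLogLT, intervalIntegral_zero_one_eq_Ioo, mul_assoc]
      rw [integral_const_mul]
      simp only [mul_comm u]
  | typeIII =>
    have hG1 := Real.Gamma_pos_of_pos (show 0 < n + 1 by linarith)
    refine h.exists_mixture hr (C := 1 / Real.Gamma (n + 1)) (by positivity) (v := fun _ => 1)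
      (g := fun s => s ^ n / Real.Gamma (n + 1)) (by simp) (by fun_prop)
      ?_ (fun m => ?_) (fun u => ?_)
    · refine (ae_restrict_iff' measurableSet_Ioo).2 (ae_of_all _ fun s hs => ?_)
      have h1 := Real.rpow_nonneg hs.1.le n
      rw [abs_of_nonneg (by positivity)]
      exact div_le_div_of_nonneg_right (Real.rpow_le_one hs.1.le hs.2.le hn.le) hG1.le
    · have h1 : ∫ s in Set.Ioo (0 : ℝ) 1, (1 : ℝ) * (s ^ n / Real.Gamma (n + 1)) ^ m =
          (∫ s in (0 : ℝ)..1, s ^ (m * n)) / Real.Gamma (n + 1) ^ m := by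
        rw [intervalIntegral_zero_one_eq_Ioo, ← integral_div]
        refine setIntegral_congr_fun measurableSet_Ioo fun s hs => ?_
        simp only [one_mul, div_pow]
        rw [← Real.rpow_mul_natCast hs.1.le, mul_comm n]
      have hmn : 0 ≤ (m : ℝ) * n := by positivity
      rw [h1, integral_rpow (Or.inl (by linarith))]
      simp only [rho]
      rw [Real.one_rpow, Real.zero_rpow (by linarith), sub_zero, div_div]
    · simp only [regulatedLogLT, one_mul, intervalIntegral_zero_one_eq_Ioo, div_mul_eq_mul_div]

end RealDegree

/-- The cumulant generating function of a regulated clock at a fixed time, near the origin. -/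
theorem IsRegulatedClock.exists_derivTower {X T : ℝ≥0 → Ω → ℝ} {r : ℝ} {D : ℕ → ℝ → ℝ}
    {kind : RegulationType} {n : ℝ} (hr : 0 < r) (h : HasCumulantTower P X r D)
    (hX : IsSubordinator X P) (hT : IsRegulatedClock P X kind n T) (Δ : ℝ≥0) :
    IsSubordinator T P ∧ ∃ r' > 0, ∃ D' : ℕ → ℝ → ℝ, IsDerivTower r' D' ∧
      (∀ z, |z| < r' → mgf (T Δ) P z = Real.exp (Δ * D' 0 z)) ∧
      ∀ m, D' m 0 = rho kind m n * D m 0 := by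
  rcases hT with ⟨k, rfl, hT⟩ | ⟨hn, hTs, hT⟩
  · obtain ⟨hTs, r', hr', D', hD', hD0⟩ := hT.exists_hasCumulantTower hr h hX kind k T
    exact ⟨hTs, r', hr', D', hD'.isDerivTower, hD'.mgf_eq Δ, hD0⟩
  · obtain ⟨r', hr', D', hD', hL, hD0⟩ := exists_derivTower_regulatedLogLT hr h hn kind
    obtain ⟨ε, hε, hball⟩ := Metric.eventually_nhds_iff.1 (hT Δ).2
    -- The Laplace identity holds on a neighbourhood that may depend on `Δ`, so the radius is shrunk
    -- for this one time.
    refine ⟨hTs, min r' ε, lt_min hr' hε, D', hD'.mono (min_le_left _ _), fun z hz => ?_, hD0⟩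
    have h1 := hball (y := -z) (by
      rw [Real.dist_eq, sub_zero, abs_neg]; exact hz.trans_le (min_le_right _ _))
    rw [hL z (hz.trans_le (min_le_left _ _))] at h1
    simp only [neg_neg] at h1
    exact h1

end Clocks

/-! ### Cumulants of the tempered stable law and conclusion -/

section TemperedStableCumulants

variable {a b c : ℝ}

theorem temperedStableTower_one : temperedStableTower a b c 1 0 =
    a * Real.Gamma (1 - c) * b ^ (c - 1) := by
  simp [temperedStableTower]

/-- Expresses all higher cumulants rationally through the first, so gamma values and real powers
enter the algebra only through `A`. -/
theorem temperedStableTower_succ (hb : 0 < b) (hc1 : c < 1) (m : ℕ) :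
    temperedStableTower a b c (m + 2) 0 =
      ((m + 1 : ℕ) - c) * temperedStableTower a b c (m + 1) 0 / b := by
  have hne : ((m + 1 : ℕ) : ℝ) - c ≠ 0 := by
    push_cast
    have : (0 : ℝ) ≤ m := Nat.cast_nonneg m
    linarith
  have hG : Real.Gamma ((m + 1 + 1 : ℕ) - c) =
      ((m + 1 : ℕ) - c) * Real.Gamma ((m + 1 : ℕ) - c) := by
    rw [← Real.Gamma_add_one hne]; congr 1; push_cast; ring
  simp only [temperedStableTower, sub_zero]
  rw [hG, show c - ((m + 1 + 1 : ℕ) : ℝ) = c - (m + 1 : ℕ) - 1 by push_cast; ring,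
    Real.rpow_sub_one hb.ne']
  ring

end TemperedStableCumulants

theorem shape_iff {a b c g δ H V : ℝ} (hb : 0 < b) (hg : 0 < g) (hδ : 0 < δ) (hH : 0 < H) :
    δ * (a * g * b ^ (c - 1)) * H = V ↔ a = V * b ^ (1 - c) / (δ * g * H) := by
  have h1 : b ^ (c - 1) * b ^ (1 - c) = 1 := by
    rw [← Real.rpow_add hb]; simp
  have h2 : 0 < b ^ (1 - c) := Real.rpow_pos_of_pos hb _
  rw [eq_div_iff (by positivity), ← mul_left_inj' h2.ne']
  have h3 : δ * (a * g * b ^ (c - 1)) * H * b ^ (1 - c) = a * (δ * g * H) := by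
    linear_combination a * g * δ * H * h1
  rw [h3]

end

theorem proposition4 {Ω : Type*} [MeasurableSpace Ω] (P : Measure Ω) [IsProbabilityMeasure P]
    (kind : RegulationType) (n : ℝ) (hn : 0 ≤ n)
    (c : ℝ) (hc0 : 0 ≤ c) (hc1 : c < 1)
    (a b μ θ : ℝ) (ha : 0 < a) (hb : 0 < b)
    (X T W : ℝ≥0 → Ω → ℝ)
    (hX : IsTemperedStableSubordinator a b c X P)
    (hT : IsRegulatedClock P X kind n T)
    (hW : IsBrownianReal W P)
    (hTW : IndepFun (fun ω t => T t ω) (fun ω t => W t ω) P)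
    (Δ : ℝ≥0) (hΔ : 0 < Δ)
    (M V SK EK : ℝ) (hV : 0 < V) (hSK : SK ≠ 0) :
    0 ∈ interior (integrableExpSet (gaussianMixture μ θ T W Δ) P) ∧
    (MomentConditions P (gaussianMixture μ θ T W Δ) M V SK EK ↔
      (b = 2 * (2 - c) * rho kind 3 n * θ ^ 2 /
          (rho kind 2 n * rootP kind n c V SK |θ|) ∧
        a = V * b ^ (1 - c) /
          (Δ * Real.Gamma (1 - c) *
            (rho kind 1 n + (1 - c) * rho kind 2 n * θ ^ 2 / b)) ∧
        μ = M / Δ - rho kind 1 n * θ * V /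
          (Δ * (rho kind 1 n + (1 - c) * rho kind 2 n * θ ^ 2 / b)) ∧
        θ = Real.sign SK * |θ| ∧
        (3 - c) * rho kind 2 n * rho kind 4 n / (4 * (2 - c) * rho kind 3 n ^ 2) *
            rootP kind n c V SK |θ| ^ 2 +
          (3 - EK * V ^ (1 / 2 : ℝ) * |θ| / (2 * |SK|)) * rootP kind n c V SK |θ| +
          3 * (1 - EK * V ^ (1 / 2 : ℝ) * |θ| / |SK|) = 0)) := by
  
  obtain ⟨hTs, r, hr, D, hD, hmgf, hD0⟩ :=
    hT.exists_derivTower hb (hX.hasCumulantTower hb hc0 hc1) hX.toIsSubordinator Δ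
  have hTm : AEMeasurable (T Δ) P := (hTs.measurable Δ).aemeasurable
  have hT0 : ∀ᵐ ω ∂P, 0 ≤ T Δ ω := by
    filter_upwards [hTs.paths] with ω hω
    rw [← hω.1]
    exact hω.2.1 zero_le
  refine ⟨zero_mem_interior_integrableExpSet_gaussianMixture hTm hT0 hW hTW hr hmgf, ?_⟩
  have hδ : (0 : ℝ) < Δ := NNReal.coe_pos.2 hΔ
  have hg : 0 < Real.Gamma (1 - c) := Real.Gamma_pos_of_pos (by linarith)
  have hA : 0 < a * Real.Gamma (1 - c) * b ^ (c - 1) := by positivity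
  have hρ : ∀ m, 0 < rho kind m n := fun m => rho_pos kind m hn
  have hc1' : 0 < 1 - c := by linarith
  have hH : 0 < rho kind 1 n + (1 - c) * rho kind 2 n * θ ^ 2 / b := by
    have h1 := hρ 1
    have h2 := hρ 2
    positivity
  have hcum := fun m (hm : m ≤ 4) =>
    cumulant_gaussianMixture (μ := μ) (θ := θ) hTm hT0 hW hTW hr hD hmgf hm
  set A := a * Real.Gamma (1 - c) * b ^ (c - 1) with hAdef
  have hD1 : D 1 0 = rho kind 1 n * A := by rw [hD0, temperedStableTower_one]
  have t2 : temperedStableTower a b c 2 0 = (1 - c) * A / b := by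
    rw [temperedStableTower_succ hb hc1 0, zero_add, temperedStableTower_one]
    push_cast; rfl
  have t3 : temperedStableTower a b c 3 0 = (2 - c) * (1 - c) * A / b ^ 2 := by
    rw [temperedStableTower_succ hb hc1 1, t2]
    push_cast; field_simp
  have t4 : temperedStableTower a b c 4 0 = (3 - c) * (2 - c) * (1 - c) * A / b ^ 3 := by
    rw [temperedStableTower_succ hb hc1 2, t3]
    push_cast; field_simp
  have hD2 : D 2 0 = rho kind 2 n * ((1 - c) * A / b) := by rw [hD0, t2]
  have hD3 : D 3 0 = rho kind 3 n * ((2 - c) * (1 - c) * A / b ^ 2) := by rw [hD0, t3]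
  have hD4 : D 4 0 = rho kind 4 n * ((3 - c) * (2 - c) * (1 - c) * A / b ^ 3) := by rw [hD0, t4]
  set v := V ^ (1 / 2 : ℝ) with hv
  have hv0 : 0 < v := Real.rpow_pos_of_pos hV _
  have hvV : V = v ^ 2 := by
    rw [hv, ← Real.rpow_natCast, ← Real.rpow_mul hV.le]; norm_num
  have hvV3 : V ^ (3 / 2 : ℝ) = v ^ 3 := by
    rw [hv, ← Real.rpow_natCast, ← Real.rpow_mul hV.le]; norm_num
  have hshape := shape_iff (a := a) (c := c) (V := V) hb hg hδ hH
  have key := moment_equations_iff (μ := μ) (θ := θ) (M := M) (EK := EK)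
    (Q := rootP kind n c V SK |θ|) hA hb hc1 (hρ 1) (hρ 2) (hρ 3) (hρ 4) hδ hv0 hSK
    (by rw [rootP, discriminantD])
  rw [← hAdef] at hshape
  rw [← hshape, MomentConditions, hcum 1 (by norm_num), hcum 2 (by norm_num),
    hcum 3 (by norm_num), hcum 4 (by norm_num), hvV3]
  simp only [gaussianMixtureTower, mul_zero, add_zero, ne_eq, OfNat.ofNat_ne_zero,
    not_false_eq_true, zero_pow, zero_div, hD1, hD2, hD3, hD4]
  rw [← hvV] at key
  rw [← key]
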